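/- Let $\mathbf F_i(x)=\tfrac12(x+a_i)$, $i=1,2,3$, with $a_1=(0,0)$, $a_2=(1,0)$, $a_3=(\tfrac12,\tfrac{\sqrt3}2)$; let $V_0=\{a_1,a_2,a_3\}$, $V_{m+1}=\bigcup_i\mathbf F_i(V_m)$, and $\hat V_m=\bigcup_{k\ge0}2^k\,[V_{m+k}\cup(-V_{m+k})]$ for $m\in\mathbb N$. Let $\mathbb S=\overline{\bigcup_m V_m}$ be the compact Sierpinski gasket and $\hat{\mathbb S}=\overline{\bigcup_m\hat V_m}$ the infinite one. Let $\{\tau_i\}_{i\in\mathbb Z}$ be the set of isometries $\pm 2^k\,\mathbf F_{w_1}\cdots\mathbf F_{w_k}$ ($k\ge0$, $w_j\in\{1,2,3\}$), so that $\hat{\mathbb S}=\bigcup_i\tau_i(\mathbb S)$ with any two of the sets $\tau_i(\mathbb S)$ meeting in at most one point. A dyadic triangle is a set $2^m\tau_i(\mathbb S)$ with $m,i\in\mathbb Z$. Let $\hat\nu$ be the Hausdorff measure on $\hat{\mathbb S}$, i.e. the Borel measure that restricts on each $\tau_i(\mathbb S)$ to the image under $\tau_i$ of the Borel probability measure $\nu$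 on $\mathbb S$ with $\nu(\mathbf F_{w_1}\cdots\mathbf F_{w_m}(\mathbb S))=3^{-m}$ for all words $w_1\cdots w_m$. For $u\in C(\hat{\mathbb S})$ let $$\hat{\mathcal E}(u)=\lim_{m\to\infty}\ \sum_{x\sim_m y}\tfrac12\,(5/3)^m\,[u(x)-u(y)]^2\in[0,\infty]$$ (the sequence is nondecreasing), where the sum is over ordered pairs of distinct corners $x,y\in\hat V_m$ of a common triangle $2^{-m}\tau_i(\mathbb S)$, and let $\mathcal F(\hat{\mathbb S})=\{u\in C(\hat{\mathbb S}):\hat{\mathcal E}(u)<\infty,\ u\in L^2(\hat\nu)\}$, which is complete in the norm $\hat{\mathcal E}(\cdot)^{1/2}+\|\cdot\|_{L^2(\hat\nu)}$. **Theorem.** Let $\hat\sigma$ be a Borel measure on $\hat{\mathbb S}$. Suppose that there are constants $p,q\in(0,\infty)$, $N\ge1$, $b_1,\dots,b_N\in[0,1)$ and $C>0$ such that $$\|u\|_{L^q(\hat\nu)}\le C\sum_{i=1}^N\hat{\mathcal E}(u)^{b_i/2}\,\|u\|_{L^p(\hat\sigma)}^{1-b_i}\qquad\text{for all }u\in\mathcal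 F(\hat{\mathbb S})$$ (norms may be infinite, and $\|u\|_{L^r}=(\int|u|^r)^{1/r}$ also when $r<1$). Then there are constants $C_{\hat\sigma}\ge1$ and $0<\underline\delta\le\bar\delta<\infty$ such that every dyadic triangle $S$ satisfies $$C_{\hat\sigma}^{-1}\,\hat\nu(S)^{1/\underline\delta}\le\hat\sigma(S)\ \text{ if }0<\operatorname{diam}(S)<1,\qquad C_{\hat\sigma}^{-1}\,\hat\nu(S)^{1/\bar\delta}\le\hat\sigma(S)\ \text{ if }\operatorname{diam}(S)\ge1,$$ where $\operatorname{diam}$ is the Euclidean diameter. -/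

import Mathlib

open MeasureTheory
open scoped ENNReal Pointwise

noncomputable section

namespace Gasket

/-- The Euclidean plane. -/
abbrev Plane : Type := EuclideanSpace ℝ (Fin 2)

/-- The three corners `(0,0)`, `(1,0)`, `(1/2, √3/2)` of the unit triangle. -/
def corner : Fin 3 → Plane :=
  ![!₂[0, 0], !₂[1, 0], !₂[1 / 2, Real.sqrt 3 / 2]]

/-- The three contractions `F i x = (x + corner i) / 2`. -/
def F (i : Fin 3) (x : Plane) : Plane := (2⁻¹ : ℝ) • (x + corner i)

/-- The composition `F w₁ ∘ F w₂ ∘ ⋯ ∘ F wₘ` along a finite word `w = w₁ w₂ ⋯ wₘ`. -/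
def Fword (w : List (Fin 3)) (x : Plane) : Plane := w.foldr F x

/-- The vertex sets `V₀` (the three corners) and `Vₘ₊₁ = ⋃ᵢ F i (Vₘ)`. -/
def V : ℕ → Set Plane
  | 0 => Set.range corner
  | m + 1 => ⋃ i : Fin 3, F i '' V m

/-- The vertex sets of the infinite gasket, `⋃ₖ 2ᵏ (Vₘ₊ₖ ∪ -Vₘ₊ₖ)`. -/
def hatV (m : ℕ) : Set Plane :=
  ⋃ k : ℕ, (2 : ℝ) ^ k • (V (m + k) ∪ -V (m + k))

/-- The compact Sierpinski gasket. -/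
def compactGasket : Set Plane := closure (⋃ m : ℕ, V m)

/-- The infinite Sierpinski gasket. -/
def gasket : Set Plane := closure (⋃ m : ℕ, hatV m)

/-- The isometries `τ` of the plane that carry the compact gasket onto the unit triangles of the
infinite gasket: the maps `x ↦ ± 2ᵏ F_w x` with `w` a word of length `k`. (`2ᵏ F_w` is a
translation; the sign is needed because the left half of the infinite gasket is `-1` times
the right half.) -/
def unitMaps : Set (Plane → Plane) :=
  {τ | ∃ (s : ℝ) (w : List (Fin 3)), (s = 1 ∨ s = -1) ∧
    τ = fun x => s • (2 : ℝ) ^ w.length • Fword w x}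

/-- Dyadic triangles: the sets `2ᵐ τ(compactGasket)`, `m ∈ ℤ`, as subsets of the infinite
gasket. -/
def IsDyadicTriangle (S : Set gasket) : Prop :=
  ∃ (m : ℤ), ∃ τ ∈ unitMaps, S = Subtype.val ⁻¹' ((2 : ℝ) ^ m • (τ '' compactGasket))

/-- The point of the compact gasket with address `ω`, that is, the unique point of
`⋂ₘ F_{ω₁ ⋯ ωₘ}(compactGasket)`. -/
def coding (ω : ℕ → Fin 3) : Plane := ∑' k : ℕ, (2⁻¹ : ℝ) ^ (k + 1) • corner (ω k)

/-- The normalised Hausdorff measure on the compact gasket, which gives mass `3⁻ᵐ` to each of the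
`3ᵐ` triangles `F_w(compactGasket)`, `w` of length `m`: the law of the point whose address is a
sequence of independent uniform letters. -/
def nu : Measure Plane :=
  (Measure.infinitePi fun _ : ℕ => (PMF.uniformOfFintype (Fin 3)).toMeasure).map coding

/-- The Hausdorff measure on the infinite gasket: a copy of `nu` on each unit triangle. (Distinct
unit triangles share at most one point, and `nu` has no atoms.) -/
def nuHat : Measure gasket :=
  (Measure.sum fun τ : unitMaps => nu.map τ.1).comap Subtype.val

/-- `x` and `y` are neighbours in the graph of level `m` on `hatV m`: distinct corners of a common
triangle of side `2⁻ᵐ`. -/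
def Neighbour (m : ℕ) (x y : Plane) : Prop :=
  x ≠ y ∧ ∃ τ ∈ unitMaps, x ∈ ((2 : ℝ) ^ m)⁻¹ • (τ '' V 0) ∧ y ∈ ((2 : ℝ) ^ m)⁻¹ • (τ '' V 0)

/-- The energy of level `m`: the sum over ordered pairs of neighbours of
`2⁻¹ (5/3)ᵐ (u x - u y)²`. -/
def energyAt (m : ℕ) (u : gasket → ℝ) : ℝ≥0∞ :=
  ∑' e : {e : gasket × gasket // Neighbour m e.1 e.2},
    ENNReal.ofReal (2⁻¹ * (5 / 3) ^ m * (u e.1.1 - u e.1.2) ^ 2)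

/-- The energy of `u`: the limit, that is the supremum, of the nondecreasing sequence of the
energies of level `m`. -/
def energy (u : gasket → ℝ) : ℝ≥0∞ := ⨆ m : ℕ, energyAt m u

/-- The domain of the standard Dirichlet form on the infinite gasket: the continuous functions for
which `energy u ^ (1/2) + ‖u‖_{L²(nuHat)}` is finite. This space is complete in that norm. -/
def domain : Set C(gasket, ℝ) := {u | energy u < ∞ ∧ MemLp u 2 nuHat}

/-- The lower dyadic condition on `σ` with constant `C`, exponent `δ₁` for triangles of diameter
less than one and exponent `δ₂` for triangles of diameter at least one. -/
def LowerDyadic (σ : Measure gasket) (C δ₁ δ₂ : ℝ) : Prop :=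
  ∀ S : Set gasket, IsDyadicTriangle S →
    ((0 < Metric.diam S ∧ Metric.diam S < 1) →
      ENNReal.ofReal C⁻¹ * nuHat S ^ (1 / δ₁) ≤ σ S) ∧
    (1 ≤ Metric.diam S →
      ENNReal.ofReal C⁻¹ * nuHat S ^ (1 / δ₂) ≤ σ S)

end Gasket

end

noncomputable section

namespace Gasket

/-! The inequality is tested on one function per dyadic triangle `S` of side `2ⁿ`: the tent function
`bump`, which vanishes at the corners of `S`, equals `1` at the midpoints of its sides, is harmonic
on its three subtriangles and is `0` outside `S`. Two triangles of the same side meet only in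
corners, so the extension by `0` is continuous (`continuous_bump`). Three estimates are needed. The
energy is at most `10 (3/5)ⁿ` (`energy_bump_le`), since a harmonic extension keeps the renormalised
energy unchanged. The tent is at most the indicator of `S`, so its `Lᵖ(σ)` norm is at most
`σ(S)^(1/p)` (`eLpNorm_bump_le`). It is at least `3/5` on a subtriangle of measure `3ⁿ⁻²`
(`le_eLpNorm_bump`).

With `θ = log(5/3)/log 3`, so that `(3/5)ⁿ = (3ⁿ)^(-θ)`, the inequality becomes a relation between
`3ⁿ`, the measure `nuHat S`, and `σ(S)`. One of the `N` terms on the right carries at least its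
share of the left side. Solving for `σ(S)` gives `σ(S) ≥ Kᵢ (3ⁿ)^(eᵢ)` with `eᵢ = (1/q + θ bᵢ/2)
p/(1 - bᵢ)` (`exists_rpow_le_of_sobolev`). The index depends on `S`, so the largest `eᵢ` serves when
`3ⁿ < 1` and the smallest when `3ⁿ ≥ 1`.

Geometry is handled through addresses: a point with two addresses is a corner of small triangles
(`coding_scons_eq`), and two triangles are nested or meet in corners (`IsCell.nested`). -/

/-! ### Addresses -/

/-- Prepend a letter to an address. -/
def scons (i : Fin 3) (ω : ℕ → Fin 3) : ℕ → Fin 3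
  | 0 => i
  | n + 1 => ω n

/-- Prepend a word to an address. -/
def cat (w : List (Fin 3)) (ω : ℕ → Fin 3) : ℕ → Fin 3 := w.foldr scons ω

/-- Delete the first letter of an address. -/
def tail (ω : ℕ → Fin 3) : ℕ → Fin 3 := fun n => ω (n + 1)

@[simp] lemma cat_nil (ω : ℕ → Fin 3) : cat [] ω = ω := rfl

@[simp] lemma cat_cons (i : Fin 3) (w : List (Fin 3)) (ω : ℕ → Fin 3) :
    cat (i :: w) ω = scons i (cat w ω) := rfl

@[simp] lemma tail_scons (i : Fin 3) (ω : ℕ → Fin 3) : tail (scons i ω) = ω := rfl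

@[simp] lemma scons_zero (i : Fin 3) (ω : ℕ → Fin 3) : scons i ω 0 = i := rfl

lemma scons_tail (ω : ℕ → Fin 3) : scons (ω 0) (tail ω) = ω := by
  funext n; cases n <;> rfl

lemma scons_const (i : Fin 3) : scons i (fun _ => i) = fun _ => i := by
  funext n; cases n <;> rfl

lemma cat_eq_const {w : List (Fin 3)} {ω : ℕ → Fin 3} {j : Fin 3}
    (h : cat w ω = fun _ => j) : ω = fun _ => j := by
  induction w with
  | nil => exact h
  | cons i w ih => exact ih (congrArg tail h)

lemma exists_cat (r : ℕ) (ω : ℕ → Fin 3) : ∃ w α, w.length = r ∧ ω = cat w α := by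
  induction r generalizing ω with
  | zero => exact ⟨[], ω, rfl, rfl⟩
  | succ r ih =>
    obtain ⟨w, α, hw, h⟩ := ih (tail ω)
    exact ⟨ω 0 :: w, α, by simp [hw], by rw [cat_cons, ← h, scons_tail]⟩

lemma continuous_tail : Continuous tail := continuous_pi fun n => continuous_apply (n + 1)

/-! ### The coding map -/

lemma corner_zero : corner 0 = 0 := by
  ext i; fin_cases i <;> simp [corner]

lemma dist_corner_le (i j : Fin 3) : dist (corner i) (corner j) ≤ 1 := by
  have h3 : Real.sqrt 3 ^ 2 = 3 := Real.sq_sqrt (by norm_num)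
  rw [EuclideanSpace.dist_eq, Real.sqrt_le_iff]
  refine ⟨zero_le_one, ?_⟩
  fin_cases i <;> fin_cases j <;>
    simp [corner, Real.dist_eq, sq_abs, div_pow, h3] <;> norm_num

lemma dist_corner_zero_one : dist (corner 0) (corner 1) = 1 := by
  rw [EuclideanSpace.dist_eq]
  simp [corner, Real.dist_eq]

lemma norm_corner_le (i : Fin 3) : ‖corner i‖ ≤ 1 := by
  simpa [corner_zero] using dist_corner_le i 0

lemma hasSum_half : HasSum (fun k : ℕ => (2⁻¹ : ℝ) ^ (k + 1)) 1 := by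
  have := (hasSum_geometric_of_lt_one (r := (2⁻¹ : ℝ)) (by norm_num) (by norm_num)).mul_left 2⁻¹
  rw [show (2⁻¹ : ℝ) * (1 - 2⁻¹)⁻¹ = 1 by norm_num] at this
  simpa only [pow_succ'] using this

lemma norm_coding_term_le (ω : ℕ → Fin 3) (k : ℕ) :
    ‖(2⁻¹ : ℝ) ^ (k + 1) • corner (ω k)‖ ≤ (2⁻¹ : ℝ) ^ (k + 1) := by
  rw [norm_smul, Real.norm_of_nonneg (by positivity)]
  exact mul_le_of_le_one_right (by positivity) (norm_corner_le _)

lemma summable_coding (ω : ℕ → Fin 3) :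
    Summable fun k : ℕ => (2⁻¹ : ℝ) ^ (k + 1) • corner (ω k) :=
  Summable.of_norm_bounded hasSum_half.summable (norm_coding_term_le ω)

lemma continuous_coding : Continuous coding := by
  refine continuous_tsum (fun k => ?_) hasSum_half.summable fun k ω => norm_coding_term_le ω k
  have h : Continuous fun ω : ℕ → Fin 3 => corner (ω k) :=
    (continuous_of_discreteTopology (f := corner)).comp (continuous_apply k)
  exact h.const_smul ((2⁻¹ : ℝ) ^ (k + 1))

lemma coding_scons (i : Fin 3) (ω : ℕ → Fin 3) : coding (scons i ω) = F i (coding ω) := by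
  unfold coding F
  rw [(summable_coding _).tsum_eq_zero_add, smul_add, add_comm, ← tsum_const_smul'']
  congr 1
  · congr 1; funext k; simp [scons, pow_succ', smul_smul]
  · simp

lemma coding_cat (w : List (Fin 3)) (ω : ℕ → Fin 3) :
    coding (cat w ω) = Fword w (coding ω) := by
  induction w with
  | nil => rfl
  | cons i w ih => rw [cat_cons, coding_scons, ih]; rfl

lemma coding_const (j : Fin 3) : coding (fun _ => j) = corner j := by
  unfold coding
  rw [hasSum_half.summable.tsum_smul_const, hasSum_half.tsum_eq, one_smul]

lemma dist_coding_le (α β : ℕ → Fin 3) : dist (coding α) (coding β) ≤ 1 := by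
  rw [dist_eq_norm]
  unfold coding
  rw [← (summable_coding α).tsum_sub (summable_coding β)]
  refine tsum_of_norm_bounded hasSum_half fun k => ?_
  rw [← smul_sub, norm_smul, Real.norm_of_nonneg (by positivity), ← dist_eq_norm]
  exact mul_le_of_le_one_right (by positivity) (dist_corner_le _ _)

lemma F_injective (i : Fin 3) : Function.Injective (F i) := fun x y h => by
  have := smul_right_injective Plane (by norm_num : (2⁻¹ : ℝ) ≠ 0) h
  simpa using this

lemma Fword_append (v w : List (Fin 3)) (x : Plane) :
    Fword (v ++ w) x = Fword v (Fword w x) := by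
  simp [Fword]

lemma Fword_cons (i : Fin 3) (w : List (Fin 3)) (x : Plane) :
    Fword (i :: w) x = F i (Fword w x) := rfl

lemma Fword_eq (w : List (Fin 3)) (x : Plane) :
    Fword w x = (2⁻¹ : ℝ) ^ w.length • x + Fword w 0 := by
  induction w with
  | nil => simp [Fword]
  | cons i w ih =>
    rw [Fword_cons, Fword_cons, ih]
    simp only [F, List.length_cons, pow_succ', smul_add, smul_smul, add_assoc]

/-! ### Barycentric coordinates -/

/-- The barycentric coordinates with respect to the three corners. -/
def bary (i : Fin 3) (x : Plane) : ℝ :=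
  ![1 - x 0 - x 1 / Real.sqrt 3, x 0 - x 1 / Real.sqrt 3, 2 * x 1 / Real.sqrt 3] i

lemma bary_F (i j : Fin 3) (x : Plane) :
    bary i (F j x) = (bary i x + if i = j then 1 else 0) / 2 := by
  have h3 : Real.sqrt 3 ≠ 0 := by positivity
  fin_cases i <;> fin_cases j <;> simp [bary, F, corner] <;> field_simp <;> ring

lemma sum_bary (x : Plane) : bary 0 x + bary 1 x + bary 2 x = 1 := by
  simp [bary]; ring

lemma continuous_bary (i : Fin 3) : Continuous (bary i) := by
  fin_cases i <;> unfold bary <;> simp <;> fun_prop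

lemma bary_coding (i : Fin 3) (ω : ℕ → Fin 3) :
    bary i (coding ω) = (bary i (coding (tail ω)) + if i = ω 0 then 1 else 0) / 2 := by
  conv_lhs => rw [← scons_tail ω, coding_scons, bary_F]

/-- At an address minimising the coordinate over the compact address space, the recursion
`bary_coding` bounds twice the minimum below by the minimum, so the minimum is not negative. -/
lemma bary_coding_nonneg (i : Fin 3) (ω : ℕ → Fin 3) : 0 ≤ bary i (coding ω) := by
  obtain ⟨ω₀, -, h⟩ := (isCompact_univ (X := ℕ → Fin 3)).exists_isMinOn Set.univ_nonempty
    ((continuous_bary i).comp continuous_coding).continuousOn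
  have h1 : bary i (coding ω₀) ≤ bary i (coding (tail ω₀)) := h (Set.mem_univ _)
  have h2 : bary i (coding ω₀) ≤ bary i (coding ω) := h (Set.mem_univ _)
  have h3 := bary_coding i ω₀
  split_ifs at h3 <;> linarith

lemma bary_coding_le_one (i : Fin 3) (ω : ℕ → Fin 3) : bary i (coding ω) ≤ 1 := by
  have h := sum_bary (coding ω)
  have h0 := bary_coding_nonneg 0 ω
  have h1 := bary_coding_nonneg 1 ω
  have h2 := bary_coding_nonneg 2 ω
  fin_cases i <;> simp <;> linarith

/-- A first letter other than `i` would halve the coordinate; hence the first letter is `i`, and the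
tail again has coordinate `1`. -/
lemma eq_const_of_bary {i : Fin 3} {ω : ℕ → Fin 3} (h : bary i (coding ω) = 1) :
    ω = fun _ => i := by
  have key : ∀ n : ℕ, ∀ ω : ℕ → Fin 3, bary i (coding ω) = 1 → ω n = i := by
    intro n
    induction n with
    | zero =>
      intro ω h
      by_contra hne
      have h1 := bary_coding i ω
      rw [if_neg (Ne.symm hne)] at h1
      linarith [bary_coding_le_one i (tail ω)]
    | succ n ih =>
      intro ω h
      refine ih (tail ω) ?_
      have h1 := bary_coding i ω
      have h2 := bary_coding_le_one i (tail ω)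
      split_ifs at h1 <;> linarith
  exact funext fun n => key n ω h

lemma add_bary_le {i j : Fin 3} (hij : i ≠ j) (ω : ℕ → Fin 3) :
    bary i (coding ω) + bary j (coding ω) ≤ 1 := by
  have h := sum_bary (coding ω)
  have h0 := bary_coding_nonneg 0 ω
  have h1 := bary_coding_nonneg 1 ω
  have h2 := bary_coding_nonneg 2 ω
  fin_cases i <;> fin_cases j <;> simp at hij ⊢ <;> linarith

/-! ### Points with several addresses -/

/-- Subtriangles `i ≠ j` share only the midpoint between corners `i` and `j`. Computing the `j`-th
coordinate of a common point in two ways gives `bary j (coding a) = 1 + bary j (coding b)`, which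
forces the value `1` for `a`; symmetrically for `b`. -/
lemma coding_scons_eq {i j : Fin 3} {a b : ℕ → Fin 3}
    (h : coding (scons i a) = coding (scons j b)) :
    (i = j ∧ coding a = coding b) ∨ (i ≠ j ∧ a = (fun _ => j) ∧ b = fun _ => i) := by
  by_cases hij : i = j
  · subst hij
    rw [coding_scons, coding_scons] at h
    exact Or.inl ⟨rfl, F_injective i h⟩
  · have hi := bary_coding i (scons i a)
    have hj := bary_coding j (scons i a)
    have hi' := bary_coding i (scons j b)
    have hj' := bary_coding j (scons j b)
    simp only [tail_scons, scons_zero, hij, Ne.symm hij, ↓reduceIte, add_zero] at hi hj hi' hj'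
    rw [h] at hi hj
    have h1 := bary_coding_nonneg i a
    have h2 := bary_coding_nonneg j b
    have h3 := bary_coding_le_one j a
    have h4 := bary_coding_le_one i b
    refine Or.inr ⟨hij, eq_const_of_bary ?_, eq_const_of_bary ?_⟩ <;>
      linarith [add_bary_le hij a, add_bary_le hij b]

lemma eq_const_of_coding_eq_corner {j : Fin 3} {ω : ℕ → Fin 3} (h : coding ω = corner j) :
    ω = fun _ => j := by
  refine eq_const_of_bary ?_
  have h1 := bary_coding j (fun _ => j)
  rw [coding_const, show tail (fun _ => j) = fun _ => j from rfl, coding_const] at h1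
  rw [h]
  simp at h1
  linarith

lemma eq_const_of_coding_cat_eq {w v : List (Fin 3)} {α β : ℕ → Fin 3}
    (h : coding (cat w α) = coding (cat v β)) (h1 : ¬ w <+: v) (h2 : ¬ v <+: w) :
    ∃ j, α = fun _ => j := by
  induction w generalizing v with
  | nil => exact absurd (List.nil_prefix) h1
  | cons i w ih =>
    cases v with
    | nil => exact absurd (List.nil_prefix) h2
    | cons j v =>
      rw [cat_cons, cat_cons] at h
      rcases coding_scons_eq h with ⟨rfl, h'⟩ | ⟨-, h, -⟩
      · exact ih h' (by simpa using h1) (by simpa using h2)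
      · exact ⟨j, cat_eq_const h⟩

/-- Ambiguous addresses are eventually constant, hence countable in number and negligible for the
measure. -/
lemma eventually_const_of_coding_eq {ω ω' : ℕ → Fin 3} (h : coding ω = coding ω')
    (hne : ω ≠ ω') : ∃ w j, ω = cat w fun _ => j := by
  have key : ∀ n : ℕ, ∀ ω ω' : ℕ → Fin 3, coding ω = coding ω' → ω n ≠ ω' n →
      ∃ w j, ω = cat w fun _ => j := by
    intro n
    induction n with
    | zero =>
      intro ω ω' h hn
      rw [← scons_tail ω, ← scons_tail ω'] at h
      rcases coding_scons_eq h with ⟨h, -⟩ | ⟨-, h, -⟩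
      · exact absurd h hn
      · exact ⟨[ω 0], ω' 0, by rw [cat_cons, cat_nil, ← h, scons_tail]⟩
    | succ n ih =>
      intro ω ω' h hn
      rw [← scons_tail ω, ← scons_tail ω'] at h
      rcases coding_scons_eq h with ⟨-, h⟩ | ⟨-, h, -⟩
      · obtain ⟨w, j, hw⟩ := ih _ _ h hn
        exact ⟨ω 0 :: w, j, by rw [cat_cons, ← hw, scons_tail]⟩
      · exact ⟨[ω 0], ω' 0, by rw [cat_cons, cat_nil, ← h, scons_tail]⟩
  obtain ⟨n, hn⟩ := Function.ne_iff.mp hne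
  exact key n _ _ h hn

/-- An address that is not constant. -/
lemma exists_not_const : ∃ γ : ℕ → Fin 3, ∀ j, γ ≠ fun _ => j := by
  refine ⟨scons 0 fun _ => 1, fun j h => ?_⟩
  have h0 := congrFun h 0
  have h1 := congrFun h 1
  simp [scons] at h0 h1
  exact absurd (h0.trans h1.symm) (by decide)

/-! ### The compact gasket -/

lemma V_subset_succ (m : ℕ) : V m ⊆ V (m + 1) := by
  induction m with
  | zero =>
    rintro _ ⟨i, rfl⟩
    refine Set.mem_iUnion.2 ⟨i, corner i, ⟨i, rfl⟩, ?_⟩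
    rw [F, ← two_smul ℝ, smul_smul]; norm_num
  | succ m ih => exact Set.iUnion_mono fun i => Set.image_mono ih

lemma V_mono : Monotone V := monotone_nat_of_le_succ V_subset_succ

lemma mem_V {m : ℕ} {x : Plane} :
    x ∈ V m ↔ ∃ (w : List (Fin 3)) (j : Fin 3), w.length = m ∧ x = Fword w (corner j) := by
  induction m generalizing x with
  | zero =>
    simp only [V, Set.mem_range, List.length_eq_zero_iff, exists_eq_left, exists_and_left]
    exact exists_congr fun j => eq_comm
  | succ m ih =>
    simp only [V, Set.mem_iUnion, Set.mem_image, ih]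
    constructor
    · rintro ⟨i, _, ⟨w, j, hw, rfl⟩, rfl⟩
      exact ⟨i :: w, j, by simp [hw], rfl⟩
    · rintro ⟨w, j, hw, rfl⟩
      cases w with
      | nil => simp at hw
      | cons i w => exact ⟨i, _, ⟨w, j, by simpa using hw, rfl⟩, rfl⟩

lemma V_subset_range (m : ℕ) : V m ⊆ Set.range coding := by
  intro x hx
  obtain ⟨w, j, -, rfl⟩ := mem_V.1 hx
  exact ⟨cat w fun _ => j, by rw [coding_cat, coding_const]⟩

lemma compactGasket_eq : compactGasket = Set.range coding := by
  apply subset_antisymm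
  · exact closure_minimal (Set.iUnion_subset V_subset_range)
      (isCompact_range continuous_coding).isClosed
  · rintro _ ⟨ω, rfl⟩
    refine Metric.mem_closure_iff.2 fun ε hε => ?_
    obtain ⟨r, hr⟩ := exists_pow_lt_of_lt_one hε (by norm_num : (2⁻¹ : ℝ) < 1)
    obtain ⟨w, α, hw, rfl⟩ := exists_cat r ω
    refine ⟨Fword w (corner 0), Set.mem_iUnion.2 ⟨r, mem_V.2 ⟨w, 0, hw, rfl⟩⟩, ?_⟩
    rw [coding_cat, Fword_eq w (coding α), Fword_eq w (corner 0), dist_add_right, dist_smul₀, hw,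
      Real.norm_of_nonneg (by positivity), ← coding_const]
    exact (mul_le_of_le_one_right (by positivity) (dist_coding_le _ _)).trans_lt hr

lemma isCompact_compactGasket : IsCompact compactGasket :=
  compactGasket_eq ▸ isCompact_range continuous_coding

/-! ### Cells -/

/-- The map `x ↦ s 2ⁿ⁺ˡ F_w x`, with `l` the length of `w`; it scales lengths by `2ⁿ`. -/
def cellMap (s : ℝ) (n : ℤ) (w : List (Fin 3)) (x : Plane) : Plane :=
  s • (2 : ℝ) ^ (n + w.length) • Fword w x

/-- `φ` maps the compact gasket onto a dyadic triangle of side `2ⁿ`. -/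
def IsCell (n : ℤ) (φ : Plane → Plane) : Prop :=
  ∃ (s : ℝ) (w : List (Fin 3)), (s = 1 ∨ s = -1) ∧ φ = cellMap s n w

/-- `F 0` is halving about the origin, and the extra factor `2` cancels it. Leading zeros therefore
allow words of any larger length, which brings two cells to a common scale. -/
lemma cellMap_pad (s : ℝ) (n : ℤ) (w : List (Fin 3)) :
    cellMap s n (0 :: w) = cellMap s n w := by
  funext x
  simp only [cellMap, Fword_cons, F, corner_zero, add_zero, List.length_cons, Nat.cast_add,
    Nat.cast_one, ← add_assoc]
  rw [zpow_add_one₀ (by norm_num), smul_smul (2 ^ _ * 2), mul_inv_cancel_right₀ two_ne_zero]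

lemma cellMap_replicate (s : ℝ) (n : ℤ) (w : List (Fin 3)) (k : ℕ) :
    cellMap s n (List.replicate k 0 ++ w) = cellMap s n w := by
  induction k with
  | zero => rfl
  | succ k ih => rw [List.replicate_succ, List.cons_append, cellMap_pad, ih]

lemma cellMap_append (s : ℝ) (n : ℤ) (w t : List (Fin 3)) :
    cellMap s n (w ++ t) = cellMap s (n + t.length) w ∘ Fword t := by
  funext x
  simp only [cellMap, Fword_append, Function.comp, List.length_append, Nat.cast_add]
  congr 3; ring

lemma IsCell.comp_Fword {n : ℤ} {φ : Plane → Plane} (h : IsCell n φ) (t : List (Fin 3)) :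
    IsCell (n - t.length) (φ ∘ Fword t) := by
  obtain ⟨s, w, hs, rfl⟩ := h
  refine ⟨s, w ++ t, hs, ?_⟩
  rw [cellMap_append, sub_add_cancel]

lemma IsCell.zpow_smul {n : ℤ} {φ : Plane → Plane} (h : IsCell n φ) (m : ℤ) :
    IsCell (n + m) fun x => (2 : ℝ) ^ m • φ x := by
  obtain ⟨s, w, hs, rfl⟩ := h
  refine ⟨s, w, hs, ?_⟩
  funext x
  simp only [cellMap]
  rw [smul_comm, smul_smul (2 ^ m), ← zpow_add₀ (by norm_num)]
  congr 3; ring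

lemma mem_unitMaps {τ : Plane → Plane} : τ ∈ unitMaps ↔ IsCell 0 τ := by
  simp only [unitMaps, IsCell, Set.mem_ofPred_eq, funext_iff, cellMap, zero_add, zpow_natCast]

/-- A cell map is a homothety with ratio `± 2ⁿ`. -/
lemma IsCell.exists_eq {n : ℤ} {φ : Plane → Plane} (h : IsCell n φ) :
    ∃ (r : ℝ) (c : Plane), |r| = 2 ^ n ∧ ∀ x, φ x = r • x + c := by
  obtain ⟨s, w, hs, rfl⟩ := h
  refine ⟨s * 2 ^ n, cellMap s n w 0, ?_, fun x => ?_⟩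
  · rw [abs_mul, abs_of_nonneg (a := (2 : ℝ) ^ n) (by positivity)]
    rcases hs with rfl | rfl <;> simp
  · simp only [cellMap]
    rw [Fword_eq w x, smul_add, smul_add, smul_smul, smul_smul]
    congr 2
    rw [zpow_add₀ (by norm_num), zpow_natCast, inv_pow]
    field_simp

lemma IsCell.dist_eq {n : ℤ} {φ : Plane → Plane} (h : IsCell n φ) (x y : Plane) :
    dist (φ x) (φ y) = 2 ^ n * dist x y := by
  obtain ⟨r, c, hr, hφ⟩ := h.exists_eq
  rw [hφ, hφ, dist_add_right, dist_smul₀, Real.norm_eq_abs, hr]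

lemma IsCell.continuous {n : ℤ} {φ : Plane → Plane} (h : IsCell n φ) : Continuous φ := by
  obtain ⟨r, c, hr, hφ⟩ := h.exists_eq
  rw [funext hφ]; fun_prop

lemma IsCell.exists_inverse {n : ℤ} {φ : Plane → Plane} (h : IsCell n φ) :
    ∃ g : Plane → Plane, Continuous g ∧ (∀ x, g (φ x) = x) ∧ ∀ y, φ (g y) = y := by
  obtain ⟨r, c, hr, hφ⟩ := h.exists_eq
  have hr0 : r ≠ 0 := abs_pos.1 (hr ▸ by positivity)
  refine ⟨fun y => r⁻¹ • (y - c), by fun_prop, fun x => ?_, fun y => ?_⟩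
  · simp only [hφ, add_sub_cancel_right, inv_smul_smul₀ hr0]
  · rw [hφ, smul_inv_smul₀ hr0, sub_add_cancel]

lemma IsCell.injective {n : ℤ} {φ : Plane → Plane} (h : IsCell n φ) : Function.Injective φ :=
  let ⟨_, _, hg, _⟩ := h.exists_inverse
  Function.LeftInverse.injective hg

lemma IsCell.isCompact_image {n : ℤ} {φ : Plane → Plane} (h : IsCell n φ) :
    IsCompact (φ '' compactGasket) :=
  isCompact_compactGasket.image h.continuous

lemma mem_image_compactGasket {φ : Plane → Plane} {x : Plane} :
    x ∈ φ '' compactGasket ↔ ∃ α, φ (coding α) = x := by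
  rw [compactGasket_eq]; simp

/-- The half of the gasket containing the unit triangle has zeroth coordinate at most `1`, its
reflection at least `1`; this separates the two halves away from the origin. -/
lemma bary_zero_neg (x : Plane) : bary 0 (-x) = 2 - bary 0 x := by
  simp [bary]; ring

/-- Two triangles meet in corners of the first one unless one contains the other. -/
lemma IsCell.nested {n n' : ℤ} {φ ψ : Plane → Plane} (hφ : IsCell n φ) (hψ : IsCell n' ψ)
    {α β : ℕ → Fin 3} (h : φ (coding α) = ψ (coding β)) (hα : ∀ j, α ≠ fun _ => j) :
    (∃ t : List (Fin 3), n = n' + t.length ∧ ψ = φ ∘ Fword t) ∨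
      ∃ t : List (Fin 3), n' = n + t.length ∧ φ = ψ ∘ Fword t := by
  obtain ⟨s, w, hs, rfl⟩ := hφ
  obtain ⟨s', v, hs', rfl⟩ := hψ
  -- Padding the shorter word equalises the powers of `2`, so that only the words remain to be
  -- compared.
  wlog hL : n + w.length = n' + v.length generalizing w v
  · rcases le_total (n + w.length) (n' + v.length) with hle | hle
    · rw [← cellMap_replicate s n w (n' + v.length - (n + w.length)).toNat] at h ⊢
      refine this _ _ h ?_
      simp; omega
    · rw [← cellMap_replicate s' n' v (n + w.length - (n' + v.length)).toNat] at h ⊢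
      refine this _ _ h ?_
      simp; omega
  have hp : (2 : ℝ) ^ (n' + v.length : ℤ) ≠ 0 := by positivity
  by_cases hss : s = s'
  · subst hss
    have hs0 : s ≠ 0 := by rcases hs with rfl | rfl <;> norm_num
    simp only [cellMap] at h
    rw [hL] at h
    have h' := smul_right_injective Plane hp (smul_right_injective Plane hs0 h)
    simp only [← coding_cat] at h'
    by_cases h1 : w <+: v
    · obtain ⟨t, rfl⟩ := h1
      have hn : n = n' + t.length := by simp at hL; omega
      exact Or.inl ⟨t, hn, by rw [cellMap_append, hn]⟩
    by_cases h2 : v <+: w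
    · obtain ⟨t, rfl⟩ := h2
      have hn : n' = n + t.length := by simp at hL; omega
      exact Or.inr ⟨t, hn, by rw [cellMap_append, hn]⟩
    obtain ⟨j, hj⟩ := eq_const_of_coding_cat_eq h' h1 h2
    exact absurd hj (hα j)
  -- Opposite signs: the common point has zeroth coordinate `1`, so it is the origin and `α` is
  -- constant.
  · exfalso
    have hneg : coding (cat w α) = -coding (cat v β) := by
      simp only [cellMap, ← coding_cat] at h
      rw [hL] at h
      apply smul_right_injective Plane hp
      rcases hs with rfl | rfl <;> rcases hs' with rfl | rfl
      · exact absurd rfl hss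
      · simpa using h
      · simpa using neg_eq_iff_eq_neg.1 (by simpa only [neg_smul, one_smul] using h)
      · exact absurd rfl hss
    have h1 := bary_zero_neg (coding (cat v β))
    rw [← hneg] at h1
    have h2 := bary_coding_le_one 0 (cat w α)
    have h3 := bary_coding_le_one 0 (cat v β)
    exact hα 0 (cat_eq_const (eq_const_of_bary (by linarith)))

lemma IsCell.eq_of_level_eq {n : ℤ} {φ ψ : Plane → Plane} (hφ : IsCell n φ) (hψ : IsCell n ψ)
    {α β : ℕ → Fin 3} (h : φ (coding α) = ψ (coding β)) (hα : ∀ j, α ≠ fun _ => j) : φ = ψ := by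
  rcases hφ.nested hψ h hα with ⟨t, ht, h⟩ | ⟨t, ht, h⟩
  · obtain rfl : t = [] := List.length_eq_zero_iff.1 (by omega)
    exact h.symm
  · obtain rfl : t = [] := List.length_eq_zero_iff.1 (by omega)
    exact h

/-! ### The infinite gasket -/

lemma isClosed_gasket : IsClosed gasket := isClosed_closure

lemma smul_compactGasket_subset {s : ℝ} (hs : s = 1 ∨ s = -1) (L : ℕ) {x : Plane}
    (hx : x ∈ compactGasket) : s • (2 : ℝ) ^ L • x ∈ gasket := by
  have hc : Continuous fun x : Plane => s • (2 : ℝ) ^ L • x := by fun_prop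
  refine map_mem_closure (f := fun x : Plane => s • (2 : ℝ) ^ L • x) hc hx ?_
  intro y hy
  beta_reduce
  obtain ⟨m, hy⟩ := Set.mem_iUnion.1 hy
  refine Set.mem_iUnion.2 ⟨m, Set.mem_iUnion.2 ⟨L, ?_⟩⟩
  have hy' := V_mono (Nat.le_add_right m L) hy
  rw [smul_comm]
  apply Set.smul_mem_smul_set
  rcases hs with rfl | rfl
  · exact Or.inl (by simpa using hy')
  · exact Or.inr (by simpa using hy')

lemma IsCell.image_subset {n : ℤ} {φ : Plane → Plane} (h : IsCell n φ) :
    φ '' compactGasket ⊆ gasket := by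
  intro x hx
  obtain ⟨α, rfl⟩ := mem_image_compactGasket.1 hx
  obtain ⟨s, w, hs, rfl⟩ := h
  rw [← cellMap_replicate s n w n.natAbs]
  simp only [cellMap, ← coding_cat]
  obtain ⟨L, hL⟩ : ∃ L : ℕ, n + (List.replicate n.natAbs (0 : Fin 3) ++ w).length = L :=
    ⟨(n + n.natAbs + w.length).toNat, by
      simp only [List.length_append, List.length_replicate]; omega⟩
  rw [hL, zpow_natCast]
  exact smul_compactGasket_subset hs L (compactGasket_eq ▸ Set.mem_range_self _)

lemma bary_zero_smul (c : ℝ) (x : Plane) : 1 - bary 0 (c • x) = c * (1 - bary 0 x) := by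
  simp [bary]; ring

lemma exists_smul_coding_of_le {k L : ℕ} (hkL : k ≤ L) (α : ℕ → Fin 3) :
    ∃ β, (2 : ℝ) ^ k • coding α = (2 : ℝ) ^ L • coding β := by
  induction L, hkL using Nat.le_induction with
  | base => exact ⟨α, rfl⟩
  | succ L _ ih =>
    obtain ⟨β, hβ⟩ := ih
    refine ⟨scons 0 β, ?_⟩
    rw [hβ, coding_scons, F, corner_zero, add_zero, pow_succ, smul_smul,
      mul_inv_cancel_right₀ two_ne_zero]

/-- The linear functional `1 - bary 0` measures size. A nonzero first letter makes it at least `2ᵏ ≥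
2ᴸ` on `2ᵏ⁺¹ • compactGasket`, so below `2ᴸ` leading letters are `0` and can be absorbed by the
scaling. -/
lemma exists_smul_coding_of_lt {k L : ℕ} (hLk : L ≤ k) (α : ℕ → Fin 3)
    (h : 1 - bary 0 ((2 : ℝ) ^ k • coding α) < 2 ^ L) :
    ∃ β, (2 : ℝ) ^ k • coding α = (2 : ℝ) ^ L • coding β := by
  induction k, hLk using Nat.le_induction generalizing α with
  | base => exact ⟨α, rfl⟩
  | succ k hk ih =>
    have h0 : α 0 = 0 := by
      by_contra hne
      rw [bary_zero_smul, bary_coding, if_neg (Ne.symm hne)] at h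
      have h1 := bary_coding_le_one 0 (tail α)
      have h2 : (2 : ℝ) ^ L ≤ 2 ^ k := pow_le_pow_right₀ (by norm_num) hk
      have h3 : (0 : ℝ) < 2 ^ k := by positivity
      rw [pow_succ] at h
      nlinarith
    have h1 : (2 : ℝ) ^ (k + 1) • coding α = (2 : ℝ) ^ k • coding (tail α) := by
      conv_lhs => rw [← scons_tail α, h0, coding_scons, F, corner_zero, add_zero, pow_succ,
        smul_smul, mul_inv_cancel_right₀ two_ne_zero]
    rw [h1] at h ⊢
    exact ih _ h

/-- The bounded part of the gasket near the origin is covered by two triangles. -/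
lemma exists_smul_coding_of_mem_gasket {x : Plane} (hx : x ∈ gasket) {L : ℕ}
    (h : |1 - bary 0 x| < 2 ^ L) :
    ∃ s : ℝ, (s = 1 ∨ s = -1) ∧ ∃ α, x = s • (2 : ℝ) ^ L • coding α := by
  set U : Set Plane := {y | |1 - bary 0 y| < 2 ^ L}
  have hU : IsOpen U :=
    isOpen_lt (continuous_const.sub (continuous_bary 0)).abs continuous_const
  set Q : Set Plane := Set.range (fun α => (2 : ℝ) ^ L • coding α) ∪
    Set.range fun α => -((2 : ℝ) ^ L • coding α)
  have hc : Continuous fun α => (2 : ℝ) ^ L • coding α :=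
    continuous_coding.const_smul ((2 : ℝ) ^ L)
  have hQ : IsClosed Q := ((isCompact_range hc).union (isCompact_range hc.neg)).isClosed
  have hsub : U ∩ ⋃ m, hatV m ⊆ Q := by
    rintro y ⟨hyU, hy⟩
    obtain ⟨m, hy⟩ := Set.mem_iUnion.1 hy
    obtain ⟨k, hy⟩ := Set.mem_iUnion.1 hy
    obtain ⟨z, hz, rfl⟩ := hy
    have key : ∀ α, |1 - bary 0 ((2 : ℝ) ^ k • coding α)| < 2 ^ L →
        ∃ β, (2 : ℝ) ^ k • coding α = (2 : ℝ) ^ L • coding β := fun α hα => by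
      rcases le_total k L with hk | hk
      · exact exists_smul_coding_of_le hk α
      · exact exists_smul_coding_of_lt hk α (abs_lt.1 hα).2
    rcases hz with hz | hz
    · obtain ⟨α, rfl⟩ := V_subset_range _ hz
      obtain ⟨β, hβ⟩ := key α hyU
      exact Or.inl ⟨β, hβ.symm⟩
    · obtain ⟨α, hα⟩ := V_subset_range _ hz
      obtain rfl : z = -coding α := by rw [hα, neg_neg]
      obtain ⟨β, hβ⟩ := key α (by
        have h1 : |1 - bary 0 ((2 : ℝ) ^ k • -coding α)| < 2 ^ L := hyU
        rw [smul_neg, bary_zero_neg] at h1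
        rw [abs_sub_comm]
        convert h1 using 2
        ring)
      exact Or.inr ⟨β, by simp only; rw [smul_neg, hβ]⟩
  have hxQ : x ∈ Q := closure_minimal hsub hQ (hU.inter_closure ⟨h, hx⟩)
  rcases hxQ with ⟨α, rfl⟩ | ⟨α, rfl⟩
  · exact ⟨1, Or.inl rfl, α, by simp⟩
  · exact ⟨-1, Or.inr rfl, α, by simp⟩

/-- The words of length `n`. -/
def words : ℕ → Finset (List (Fin 3))
  | 0 => {[]}
  | n + 1 => (Finset.univ ×ˢ words n).image fun p => p.1 :: p.2

lemma mem_words {n : ℕ} {w : List (Fin 3)} : w ∈ words n ↔ w.length = n := by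
  induction n generalizing w with
  | zero => simp [words]
  | succ n ih =>
    cases w with
    | nil => simp [words]
    | cons i w => simp [words, ih]

lemma sum_words_succ {M : Type*} [AddCommMonoid M] (n : ℕ) (f : List (Fin 3) → M) :
    ∑ w ∈ words (n + 1), f w = ∑ i, ∑ w ∈ words n, f (i :: w) := by
  rw [words, Finset.sum_image (by simp +contextual [Set.InjOn]), Finset.sum_product]

/-- The triangles of side `2ⁿ` form a locally finite closed cover of the gasket, so a function that
is continuous on each of them is continuous. -/
lemma continuous_of_continuousOn_cells (n : ℤ) {U : Plane → ℝ}
    (hU : ∀ ψ, IsCell n ψ → ContinuousOn U (ψ '' compactGasket)) :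
    Continuous fun x : gasket => U x := by
  rw [continuous_iff_continuousAt]
  rintro ⟨x, hx⟩
  obtain ⟨L₀, hL₀⟩ := pow_unbounded_of_one_lt |1 - bary 0 x| (by norm_num : (1 : ℝ) < 2)
  obtain ⟨L, hL, hnL⟩ : ∃ L : ℕ, |1 - bary 0 x| < 2 ^ L ∧ n ≤ L :=
    ⟨max L₀ n.toNat, hL₀.trans_le (pow_le_pow_right₀ (by norm_num) (le_max_left _ _)), by omega⟩
  -- Words of length `L - n` cut the two triangles of side `2ᴸ` at the origin into triangles of side
  -- `2ⁿ`.
  set r : ℕ := (L - n).toNat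
  set Q : Set Plane := ⋃ p : Bool × words r,
    cellMap (if p.1 then 1 else -1) n p.2 '' compactGasket
  have hcell : ∀ p : Bool × words r, IsCell n (cellMap (if p.1 then 1 else -1) n p.2) :=
    fun p => ⟨_, _, by cases p.1 <;> simp, rfl⟩
  have hQ : ContinuousOn U Q :=
    (locallyFinite_of_finite _).continuousOn_iUnion
      (fun p => (hcell p).isCompact_image.isClosed) fun p => hU _ (hcell p)
  have hcov : ∀ y ∈ gasket, |1 - bary 0 y| < 2 ^ L → y ∈ Q := by
    intro y hy hyL
    obtain ⟨s, hs, α, rfl⟩ := exists_smul_coding_of_mem_gasket hy hyL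
    obtain ⟨w, β, hw, rfl⟩ := exists_cat r α
    have he : (2 : ℝ) ^ L = 2 ^ (n + w.length) := by
      rw [← zpow_natCast, hw]; congr 1; omega
    have hm : s • (2 : ℝ) ^ L • coding (cat w β) = cellMap s n w (coding β) := by
      rw [cellMap, coding_cat, he]
    rw [hm]
    refine Set.mem_iUnion.2 ⟨(decide (s = 1), ⟨w, mem_words.2 hw⟩), ?_⟩
    refine mem_image_compactGasket.2 ⟨β, ?_⟩
    rcases hs with rfl | rfl <;> norm_num
  have hN : {y : gasket | |1 - bary 0 y| < 2 ^ L} ∈ nhds (⟨x, hx⟩ : gasket) :=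
    (isOpen_lt (continuous_const.sub ((continuous_bary 0).comp continuous_subtype_val)).abs
      continuous_const).mem_nhds hL
  have h1 : ContinuousOn (fun y : gasket => U y) {y : gasket | |1 - bary 0 y| < 2 ^ L} :=
    hQ.comp continuous_subtype_val.continuousOn fun y hy => hcov y y.2 hy
  exact h1.continuousAt hN

/-! ### Harmonic functions on the compact gasket -/

/-- The corner values on the `i`-th subtriangle of the harmonic function with corner values `v`. -/
def harmonicStep (i : Fin 3) (v : Fin 3 → ℝ) (j : Fin 3) : ℝ :=
  if j = i then v i else (v i + v j + (v 0 + v 1 + v 2)) / 5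

/-- The corner values on the triangle with address `w`. -/
def harmonicWord (w : List (Fin 3)) (v : Fin 3 → ℝ) : Fin 3 → ℝ :=
  w.foldl (fun v i => harmonicStep i v) v

/-- The value at the first corner of the triangle with address `ω₀ ⋯ ωₘ₋₁`. -/
def harmonicApprox : ℕ → (Fin 3 → ℝ) → (ℕ → Fin 3) → ℝ
  | 0, v, _ => v 0
  | m + 1, v, ω => harmonicApprox m (harmonicStep (ω 0) v) (tail ω)

/-- The harmonic function with corner values `v`, as a function of the address. -/
def harmonic (v : Fin 3 → ℝ) (ω : ℕ → Fin 3) : ℝ :=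
  v 0 + ∑' m, (harmonicApprox (m + 1) v ω - harmonicApprox m v ω)

/-- A new difference is, up to sign, `(v j - v k)/5` or `(2(v i - v j) + (v i - v k))/5`. The
contraction makes `harmonicApprox` converge geometrically, uniformly in the address. -/
lemma harmonicStep_osc {v : Fin 3 → ℝ} {d : ℝ} (h : ∀ j k, |v j - v k| ≤ d) (i j k : Fin 3) :
    |harmonicStep i v j - harmonicStep i v k| ≤ 3 / 5 * d := by
  have h01 := abs_le.1 (h 0 1)
  have h02 := abs_le.1 (h 0 2)
  have h12 := abs_le.1 (h 1 2)
  refine abs_le.2 ⟨?_, ?_⟩ <;>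
    fin_cases i <;> fin_cases j <;> fin_cases k <;> simp [harmonicStep] <;> linarith

lemma harmonicStep_mem {v : Fin 3 → ℝ} {a b : ℝ} (h : ∀ j, v j ∈ Set.Icc a b) (i j : Fin 3) :
    harmonicStep i v j ∈ Set.Icc a b := by
  have h0 := h 0
  have h1 := h 1
  have h2 := h 2
  have hi := h i
  have hj := h j
  simp only [Set.mem_Icc] at *
  unfold harmonicStep
  split_ifs
  · exact hi
  · constructor <;> linarith

lemma harmonicApprox_mem {v : Fin 3 → ℝ} {a b : ℝ} (h : ∀ j, v j ∈ Set.Icc a b) (m : ℕ)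
    (ω : ℕ → Fin 3) : harmonicApprox m v ω ∈ Set.Icc a b := by
  induction m generalizing v ω with
  | zero => exact h 0
  | succ m ih => exact ih (harmonicStep_mem h _) _

lemma abs_harmonicApprox_sub_le {v : Fin 3 → ℝ} {d : ℝ} (h : ∀ j k, |v j - v k| ≤ d) (m : ℕ)
    (ω : ℕ → Fin 3) :
    |harmonicApprox (m + 1) v ω - harmonicApprox m v ω| ≤ (3 / 5) ^ m * d := by
  induction m generalizing v d ω with
  | zero =>
    have h1 : ∀ j, v j ∈ Set.Icc (v 0 - d) (v 0 + d) := fun j => by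
      have := abs_le.1 (h j 0)
      constructor <;> linarith
    have h2 := harmonicStep_mem h1 (ω 0) 0
    simp only [harmonicApprox, pow_zero, one_mul, abs_le]
    constructor <;> linarith [h2.1, h2.2]
  | succ m ih =>
    rw [pow_succ, mul_assoc]
    exact ih (harmonicStep_osc h (ω 0)) (tail ω)

lemma exists_osc (v : Fin 3 → ℝ) : ∃ d, ∀ j k, |v j - v k| ≤ d := by
  refine ⟨∑ p : Fin 3 × Fin 3, |v p.1 - v p.2|, fun j k => ?_⟩
  exact Finset.single_le_sum (f := fun p : Fin 3 × Fin 3 => |v p.1 - v p.2|)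
    (fun _ _ => abs_nonneg _) (Finset.mem_univ (j, k))

lemma summable_geometric_mul (d : ℝ) : Summable fun m : ℕ => (3 / 5 : ℝ) ^ m * d :=
  (summable_geometric_of_lt_one (by norm_num) (by norm_num)).mul_right d

lemma tendsto_harmonicApprox (v : Fin 3 → ℝ) (ω : ℕ → Fin 3) :
    Filter.Tendsto (fun m => harmonicApprox m v ω) Filter.atTop (nhds (harmonic v ω)) := by
  obtain ⟨d, hd⟩ := exists_osc v
  have hs : Summable fun m => harmonicApprox (m + 1) v ω - harmonicApprox m v ω :=
    Summable.of_norm_bounded (summable_geometric_mul d) fun m => abs_harmonicApprox_sub_le hd m ω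
  have h := hs.hasSum.tendsto_sum_nat.const_add (v 0)
  refine h.congr fun m => ?_
  rw [Finset.sum_range_sub fun m => harmonicApprox m v ω]
  simp [harmonicApprox]

lemma harmonic_scons (v : Fin 3 → ℝ) (i : Fin 3) (ω : ℕ → Fin 3) :
    harmonic v (scons i ω) = harmonic (harmonicStep i v) ω :=
  tendsto_nhds_unique ((tendsto_harmonicApprox v (scons i ω)).comp (Filter.tendsto_add_atTop_nat 1))
    (tendsto_harmonicApprox (harmonicStep i v) ω)

lemma harmonic_cat (v : Fin 3 → ℝ) (w : List (Fin 3)) (ω : ℕ → Fin 3) :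
    harmonic v (cat w ω) = harmonic (harmonicWord w v) ω := by
  induction w generalizing v with
  | nil => rfl
  | cons i w ih => rw [cat_cons, harmonic_scons, ih]; rfl

lemma harmonic_mem {v : Fin 3 → ℝ} {a b : ℝ} (h : ∀ j, v j ∈ Set.Icc a b) (ω : ℕ → Fin 3) :
    harmonic v ω ∈ Set.Icc a b :=
  isClosed_Icc.mem_of_tendsto (tendsto_harmonicApprox v ω)
    (Filter.Eventually.of_forall fun m => harmonicApprox_mem h m ω)

lemma abs_harmonic_sub_le {v : Fin 3 → ℝ} {d : ℝ} (h : ∀ j k, |v j - v k| ≤ d) (ω : ℕ → Fin 3)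
    (k : Fin 3) : |harmonic v ω - v k| ≤ d := by
  have h1 : ∀ j, v j ∈ Set.Icc (v k - d) (v k + d) := fun j => by
    have := abs_le.1 (h j k)
    constructor <;> linarith
  have h2 := harmonic_mem h1 ω
  rw [abs_le]
  constructor <;> linarith [h2.1, h2.2]

lemma eq_of_abs_sub_le_geometric {x y d : ℝ} (h : ∀ n : ℕ, |x - y| ≤ (3 / 5) ^ n * d) : x = y := by
  have h0 : Filter.Tendsto (fun n : ℕ => (3 / 5 : ℝ) ^ n * d) Filter.atTop (nhds 0) := by
    simpa using (tendsto_pow_atTop_nhds_zero_of_lt_one (by norm_num : (0 : ℝ) ≤ 3 / 5)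
      (by norm_num)).mul_const d
  have := ge_of_tendsto' h0 h
  exact sub_eq_zero.1 (abs_nonpos_iff.1 this)

lemma harmonic_const (v : Fin 3 → ℝ) (j : Fin 3) : harmonic v (fun _ => j) = v j := by
  obtain ⟨d, hd⟩ := exists_osc v
  refine eq_of_abs_sub_le_geometric (d := d) fun n => ?_
  induction n generalizing v d with
  | zero => simpa using abs_harmonic_sub_le hd _ j
  | succ n ih =>
    have h := ih (harmonicStep j v) _ (harmonicStep_osc hd j)
    rw [← harmonic_scons, scons_const] at h
    rw [pow_succ, mul_assoc]
    simpa [harmonicStep] using h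

/-- Well-definedness on points. With equal first letters one descends, gaining a factor `3/5`; with
different ones the point is a midpoint, where the symmetric step rule gives the same value from both
sides. -/
lemma harmonic_eq_of_coding_eq (v : Fin 3 → ℝ) {ω ω' : ℕ → Fin 3} (h : coding ω = coding ω') :
    harmonic v ω = harmonic v ω' := by
  obtain ⟨d, hd⟩ := exists_osc v
  refine eq_of_abs_sub_le_geometric (d := 2 * d) fun n => ?_
  induction n generalizing v d ω ω' with
  | zero =>
    have h1 := abs_le.1 (abs_harmonic_sub_le hd ω 0)
    have h2 := abs_le.1 (abs_harmonic_sub_le hd ω' 0)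
    rw [abs_le]
    constructor <;> linarith [h1.1, h1.2, h2.1, h2.2]
  | succ n ih =>
    rw [← scons_tail ω, ← scons_tail ω'] at h ⊢
    rw [harmonic_scons, harmonic_scons]
    rcases coding_scons_eq h with ⟨h0, h1⟩ | ⟨h0, h1, h2⟩
    · rw [← h0]
      have := ih _ h1 _ (harmonicStep_osc hd (ω 0))
      rw [pow_succ]
      linarith
    · rw [h1, h2, harmonic_const, harmonic_const]
      simp only [harmonicStep, h0, Ne.symm h0, ↓reduceIte, add_comm (v (ω 0)), sub_self, abs_zero]
      have := (abs_nonneg _).trans (hd 0 0)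
      positivity

lemma continuous_of_letter {f : Fin 3 → (ℕ → Fin 3) → ℝ} (hf : ∀ i, Continuous (f i)) :
    Continuous fun ω : ℕ → Fin 3 => f (ω 0) (tail ω) := by
  have h : Continuous fun p : Fin 3 × (ℕ → Fin 3) => f p.1 p.2 :=
    continuous_prod_of_discrete_left.2 hf
  exact h.comp ((continuous_apply 0).prodMk continuous_tail)

lemma continuous_harmonicApprox (m : ℕ) (v : Fin 3 → ℝ) : Continuous (harmonicApprox m v) := by
  induction m generalizing v with
  | zero => exact continuous_const
  | succ m ih => exact continuous_of_letter fun i => ih (harmonicStep i v)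

lemma continuous_harmonic (v : Fin 3 → ℝ) : Continuous (harmonic v) := by
  obtain ⟨d, hd⟩ := exists_osc v
  refine continuous_const.add (continuous_tsum (fun m => ?_) (summable_geometric_mul d)
    fun m ω => abs_harmonicApprox_sub_le hd m ω)
  exact (continuous_harmonicApprox _ v).sub (continuous_harmonicApprox _ v)

/-- Twice the energy of the values `v` at the corners of a triangle. -/
def cornerEnergy (v : Fin 3 → ℝ) : ℝ := ∑ i, ∑ j, (v i - v j) ^ 2

/-- The factor `3/5` is exactly compensated by `(5/3)ᵐ` in the energy, so refining the graph does
not change the energy of a harmonic function. -/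
lemma sum_cornerEnergy_step (v : Fin 3 → ℝ) :
    ∑ i, cornerEnergy (harmonicStep i v) = 3 / 5 * cornerEnergy v := by
  simp [cornerEnergy, harmonicStep, Fin.sum_univ_three]
  ring

lemma sum_cornerEnergy_word (r : ℕ) (v : Fin 3 → ℝ) :
    ∑ w ∈ words r, cornerEnergy (harmonicWord w v) = (3 / 5) ^ r * cornerEnergy v := by
  induction r generalizing v with
  | zero => simp [words, harmonicWord]
  | succ r ih =>
    rw [sum_words_succ]
    have : ∀ i, ∑ w ∈ words r, cornerEnergy (harmonicWord (i :: w) v) =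
        (3 / 5) ^ r * cornerEnergy (harmonicStep i v) := fun i => ih (harmonicStep i v)
    simp_rw [this]
    rw [← Finset.mul_sum, sum_cornerEnergy_step]
    ring

/-! ### The tent function -/

/-- The values of the tent function at the corners of the `i`-th subtriangle. -/
def tentValue (i j : Fin 3) : ℝ := if j = i then 0 else 1

/-- The tent function as a function of the address. -/
def tentCode (ω : ℕ → Fin 3) : ℝ := harmonic (tentValue (ω 0)) (tail ω)

lemma tentCode_eq_of_coding_eq {ω ω' : ℕ → Fin 3} (h : coding ω = coding ω') :
    tentCode ω = tentCode ω' := by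
  rw [← scons_tail ω, ← scons_tail ω'] at h
  rcases coding_scons_eq h with ⟨h0, h1⟩ | ⟨h0, h1, h2⟩
  · rw [tentCode, tentCode, h0, harmonic_eq_of_coding_eq _ h1]
  · rw [tentCode, tentCode, h1, h2, harmonic_const, harmonic_const]
    simp [tentValue, h0, Ne.symm h0]

open Classical in
/-- The function on the compact gasket that vanishes at the corners, is `1` at the midpoints of the
sides and is harmonic elsewhere, extended by `0` to the plane. -/
def tent (x : Plane) : ℝ := if h : ∃ ω, coding ω = x then tentCode h.choose else 0

lemma tent_coding (ω : ℕ → Fin 3) : tent (coding ω) = tentCode ω := by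
  have h : ∃ ω', coding ω' = coding ω := ⟨ω, rfl⟩
  rw [tent, dif_pos h]
  exact tentCode_eq_of_coding_eq h.choose_spec

/-- The nonconstant address is the hypothesis needed for `IsCell.nested`: the tent lives away from
the corners. -/
lemma exists_of_tent_ne_zero {x : Plane} (hx : tent x ≠ 0) :
    ∃ α, x = coding α ∧ ∀ j, α ≠ fun _ => j := by
  by_cases h : ∃ ω, coding ω = x
  · obtain ⟨α, rfl⟩ := h
    refine ⟨α, rfl, ?_⟩
    rintro j rfl
    refine hx ?_
    rw [tent_coding, tentCode, show tail (fun _ => j) = fun _ => j from rfl, harmonic_const]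
    simp [tentValue]
  · exact absurd (dif_neg h) hx

lemma tent_mem_Icc (x : Plane) : tent x ∈ Set.Icc (0 : ℝ) 1 := by
  by_cases h : ∃ ω, coding ω = x
  · obtain ⟨α, rfl⟩ := h
    rw [tent_coding]
    refine harmonic_mem (fun j => ?_) _
    unfold tentValue
    split_ifs <;> simp
  · rw [show tent x = 0 from dif_neg h]; simp

lemma tent_corner_of_cons (i : Fin 3) (w : List (Fin 3)) (j : Fin 3) :
    tent (Fword (i :: w) (corner j)) = harmonicWord w (tentValue i) j := by
  rw [← coding_const, ← coding_cat, tent_coding, cat_cons, tentCode, tail_scons, scons_zero,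
    harmonic_cat, harmonic_const]

/-- On the subtriangle `[0, 1]` the corner values are `3/5, 1, 4/5`; the maximum principle does the
rest. -/
lemma tent_ge (ω : ℕ → Fin 3) : 3 / 5 ≤ tent (Fword [0, 1] (coding ω)) := by
  rw [← coding_cat, tent_coding, cat_cons, tentCode, tail_scons, scons_zero, harmonic_cat]
  refine (harmonic_mem (a := 3 / 5) (b := 1) (fun j => ?_) ω).1
  fin_cases j <;> simp [harmonicWord, harmonicStep, tentValue] <;> norm_num

/-- `coding` is a closed surjection from a compact space onto the gasket, so continuity can be
checked on addresses. -/
lemma continuousOn_tent : ContinuousOn tent compactGasket := by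
  have hcode : Continuous tentCode := continuous_of_letter fun i => continuous_harmonic _
  have hc : Continuous (Set.rangeFactorization coding) :=
    continuous_coding.subtype_mk _
  have hq : Topology.IsQuotientMap (Set.rangeFactorization coding) :=
    hc.isClosedMap.isQuotientMap hc Set.rangeFactorization_surjective
  rw [compactGasket_eq, continuousOn_iff_continuous_domRestrict, hq.continuous_iff]
  exact hcode.congr fun ω => (tent_coding ω).symm

lemma sum_cornerEnergy_tent (r : ℕ) :
    ∑ w ∈ words (r + 1), cornerEnergy (fun j => tent (Fword w (corner j))) =
      12 * (3 / 5) ^ r := by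
  rw [sum_words_succ]
  simp only [tent_corner_of_cons]
  simp_rw [sum_cornerEnergy_word, ← Finset.mul_sum]
  -- Each of the three subtriangles has corner values `0, 1, 1` and contributes `4` over ordered
  -- pairs.
  have : ∑ i, cornerEnergy (tentValue i) = 12 := by
    simp [cornerEnergy, tentValue, Fin.sum_univ_three]; norm_num
  rw [this, mul_comm]

/-! ### The Hausdorff measure of triangles -/

/-- The law of a sequence of independent uniform letters. -/
abbrev letterMeasure : Measure (ℕ → Fin 3) :=
  Measure.infinitePi fun _ : ℕ => (PMF.uniformOfFintype (Fin 3)).toMeasure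

lemma cylinder_eq (w : List (Fin 3)) :
    Set.range (cat w) = Set.pi (Finset.range w.length) fun k => {w.getD k 0} := by
  induction w with
  | nil => ext ω; simp
  | cons i w ih =>
    ext ω
    have h := Set.ext_iff.1 ih (tail ω)
    simp only [Set.mem_range, Set.mem_pi, Finset.coe_range, Set.mem_Iio,
      Set.mem_singleton_iff] at h ⊢
    constructor
    · rintro ⟨α, rfl⟩ k hk
      cases k with
      | zero => rfl
      | succ k => exact h.1 ⟨α, rfl⟩ k (by simpa using hk)
    · intro hω
      obtain ⟨α, hα⟩ := h.2 fun k hk => hω (k + 1) (by simpa using hk)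
      refine ⟨α, ?_⟩
      rw [cat_cons, hα, ← show ω 0 = i from hω 0 (by simp), scons_tail]

lemma letterMeasure_cylinder (w : List (Fin 3)) :
    letterMeasure (Set.range (cat w)) = 3⁻¹ ^ w.length := by
  rw [cylinder_eq, Measure.infinitePi_pi _ fun _ _ => .singleton _]
  simp

lemma letterMeasure_singleton (ω : ℕ → Fin 3) : letterMeasure {ω} = 0 := by
  have h : ∀ r : ℕ, letterMeasure {ω} ≤ (3⁻¹ : ℝ≥0∞) ^ r := fun r => by
    obtain ⟨w, α, hw, rfl⟩ := exists_cat r ω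
    rw [← hw, ← letterMeasure_cylinder w]
    exact measure_mono (by rintro _ rfl; exact ⟨α, rfl⟩)
  refine le_antisymm (ge_of_tendsto' (ENNReal.tendsto_pow_atTop_nhds_zero_of_lt_one ?_) h) zero_le
  rw [ENNReal.inv_lt_one]
  norm_num

instance : NullSingletonClass letterMeasure := ⟨letterMeasure_singleton⟩

lemma measurable_coding : Measurable coding := continuous_coding.measurable

lemma nu_apply {A : Set Plane} (hA : MeasurableSet A) :
    nu A = letterMeasure (coding ⁻¹' A) :=
  Measure.map_apply measurable_coding hA

lemma letterMeasure_eventually_const :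
    letterMeasure {ω | ∃ w j, ω = cat w fun _ => j} = 0 := by
  refine Set.Countable.measure_zero ?_ _
  refine (Set.countable_range fun p : List (Fin 3) × Fin 3 => cat p.1 fun _ => p.2).mono ?_
  rintro _ ⟨w, j, rfl⟩
  exact ⟨(w, j), rfl⟩

lemma letterMeasure_const : letterMeasure {ω | ∃ j, ω = fun _ => j} = 0 :=
  measure_mono_null (by rintro _ ⟨j, rfl⟩; exact ⟨[], j, rfl⟩) letterMeasure_eventually_const

lemma isCompact_image_Fword (w : List (Fin 3)) : IsCompact (Fword w '' compactGasket) := by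
  refine isCompact_compactGasket.image ?_
  rw [funext (Fword_eq w)]
  fun_prop

/-- The preimage under `coding` is the cylinder of `w` up to ambiguous addresses, a null set. -/
lemma nu_image_Fword (w : List (Fin 3)) : nu (Fword w '' compactGasket) = 3⁻¹ ^ w.length := by
  rw [nu_apply (isCompact_image_Fword w).isClosed.measurableSet, ← letterMeasure_cylinder]
  apply le_antisymm
  · have hsub : coding ⁻¹' (Fword w '' compactGasket) ⊆
        Set.range (cat w) ∪ {ω | ∃ w j, ω = cat w fun _ => j} := by
      intro ω hω
      obtain ⟨α, hα⟩ := mem_image_compactGasket.1 hω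
      rw [← coding_cat] at hα
      by_cases h : ω = cat w α
      · exact Or.inl ⟨α, h.symm⟩
      · exact Or.inr (eventually_const_of_coding_eq hα.symm h)
    refine (measure_mono hsub).trans ((measure_union_le _ _).trans ?_)
    rw [letterMeasure_eventually_const, add_zero]
  · refine measure_mono ?_
    rintro _ ⟨α, rfl⟩
    exact mem_image_compactGasket.2 ⟨α, (coding_cat w α).symm⟩

lemma nu_preimage_eq_zero {τ : Plane → Plane} {A : Set Plane} (hτ : Continuous τ)
    (hA : MeasurableSet A) (h : ∀ α, τ (coding α) ∈ A → ∃ j, α = fun _ => j) :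
    nu (τ ⁻¹' A) = 0 := by
  rw [nu_apply (hτ.measurable hA)]
  exact measure_mono_null h letterMeasure_const

lemma measurableSet_image {n : ℤ} {φ : Plane → Plane} (hφ : IsCell n φ) :
    MeasurableSet (φ '' compactGasket) := hφ.isCompact_image.isClosed.measurableSet

/-- Ensures that sums over subtriangles can be indexed by words without repetition; two words are
distinguished at a point with nonconstant address. -/
lemma IsCell.comp_Fword_injOn {n : ℤ} {φ : Plane → Plane} (hφ : IsCell n φ) (r : ℕ) :
    Set.InjOn (fun t => φ ∘ Fword t) (words r : Set (List (Fin 3))) := by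
  intro t ht t' ht' h
  obtain ⟨γ, hγ⟩ := exists_not_const
  have h1 : Fword t (coding γ) = Fword t' (coding γ) := hφ.injective (congrFun h (coding γ))
  rw [← coding_cat, ← coding_cat] at h1
  have hl : t.length = t'.length := by
    rw [mem_words.1 (Finset.mem_coe.1 ht), mem_words.1 (Finset.mem_coe.1 ht')]
  by_cases hp : t <+: t'
  · exact hp.eq_of_length hl
  by_cases hp' : t' <+: t
  · exact (hp'.eq_of_length hl.symm).symm
  obtain ⟨j, hj⟩ := eq_const_of_coding_cat_eq h1 hp hp'
  exact absurd hj (hγ j)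

/-- Sum over the unit triangles that lie in a given triangle. -/
lemma tsum_nu_of_nonneg {φ : Plane → Plane} {r : ℕ} (hφ : IsCell r φ) :
    ∑' τ : unitMaps, nu (τ.1 ⁻¹' (φ '' compactGasket)) = 3 ^ r := by
  classical
  have hτ : ∀ t ∈ words r, φ ∘ Fword t ∈ unitMaps := fun t ht => by
    have := hφ.comp_Fword t
    rw [mem_words.1 ht, sub_self] at this
    exact mem_unitMaps.2 this
  rw [tsum_subtype unitMaps fun τ => nu (τ ⁻¹' (φ '' compactGasket)),
    tsum_eq_sum (s := (words r).image fun t => φ ∘ Fword t), Finset.sum_image (hφ.comp_Fword_injOn r)]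
  · have h1 : ∀ t ∈ words r, unitMaps.indicator (fun τ => nu (τ ⁻¹' (φ '' compactGasket)))
        (φ ∘ Fword t) = 1 := fun t ht => by
      rw [Set.indicator_of_mem (hτ t ht)]
      have hsub : coding ⁻¹' ((φ ∘ Fword t) ⁻¹' (φ '' compactGasket)) = Set.univ := by
        refine Set.eq_univ_of_forall fun α => mem_image_compactGasket.2 ⟨cat t α, ?_⟩
        rw [coding_cat]; rfl
      rw [nu_apply ((mem_unitMaps.1 (hτ t ht)).continuous.measurable (measurableSet_image hφ)), hsub,
        measure_univ]
    rw [Finset.sum_congr rfl h1, Finset.sum_const, nsmul_one]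
    have hcard : ∀ r, (words r).card = 3 ^ r := fun r => by
      induction r with
      | zero => simp [words]
      | succ r ih => rw [Finset.card_eq_sum_ones, sum_words_succ]; simp [ih, pow_succ']
    simp [hcard]
  · intro τ hnot
    by_cases hmem : τ ∈ unitMaps
    · rw [Set.indicator_of_mem hmem]
      have hcell := mem_unitMaps.1 hmem
      refine nu_preimage_eq_zero hcell.continuous (measurableSet_image hφ) fun β hβ => ?_
      by_contra! hc
      obtain ⟨α, hα⟩ := mem_image_compactGasket.1 hβ
      refine hnot (Finset.mem_image.2 ?_)
      rcases hcell.nested hφ hα.symm hc with ⟨t, ht, h⟩ | ⟨t, ht, h⟩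
      · have : t = [] := List.length_eq_zero_iff.1 (by omega)
        subst this
        exact ⟨[], mem_words.2 (by simp at ht ⊢; omega), h⟩
      · exact ⟨t, mem_words.2 (by omega), h.symm⟩
    · exact Set.indicator_of_notMem hmem _

lemma tsum_nu_of_nonpos {φ : Plane → Plane} {r : ℕ} (hφ : IsCell (-r) φ) :
    ∑' τ : unitMaps, nu (τ.1 ⁻¹' (φ '' compactGasket)) = 3⁻¹ ^ r := by
  -- A small triangle lies in one unit triangle: after padding, its word is long enough to split off
  -- the last `r` letters.
  obtain ⟨τ, t, hτ, ht, rfl⟩ : ∃ τ t, IsCell 0 τ ∧ t.length = r ∧ φ = τ ∘ Fword t := by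
    obtain ⟨s, w, hs, rfl⟩ := hφ
    rw [← cellMap_replicate s _ w r]
    set w' := List.replicate r (0 : Fin 3) ++ w with hw'
    refine ⟨cellMap s 0 (w'.take w.length), w'.drop w.length, ⟨s, _, hs, rfl⟩, by simp [hw'], ?_⟩
    conv_lhs => rw [← List.take_append_drop w.length w', cellMap_append]
    simp [hw']
  rw [tsum_eq_single (⟨τ, mem_unitMaps.2 hτ⟩ : unitMaps)]
  · simp only [Set.image_comp]
    rw [Set.preimage_image_eq _ hτ.injective, nu_image_Fword, ht]
  · rintro ⟨τ', hτ'⟩ hne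
    have hcell := mem_unitMaps.1 hτ'
    refine nu_preimage_eq_zero hcell.continuous (measurableSet_image hφ) fun β hβ => ?_
    by_contra! hc
    obtain ⟨α, hα⟩ := mem_image_compactGasket.1 hβ
    refine hne (Subtype.ext ?_)
    refine hcell.eq_of_level_eq hτ (α := β) (β := cat t α) ?_ hc
    rw [coding_cat]; exact hα.symm

/-- A triangle of side `2ⁿ`, as a subset of the gasket. -/
def cellSet (φ : Plane → Plane) : Set gasket := Subtype.val ⁻¹' (φ '' compactGasket)

lemma image_cellSet {n : ℤ} {φ : Plane → Plane} (hφ : IsCell n φ) :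
    Subtype.val '' cellSet φ = φ '' compactGasket := by
  rw [cellSet, Subtype.image_preimage_coe, Set.inter_eq_right]
  exact hφ.image_subset

lemma measurableSet_cellSet {n : ℤ} {φ : Plane → Plane} (hφ : IsCell n φ) :
    MeasurableSet (cellSet φ) := measurable_subtype_coe (measurableSet_image hφ)

lemma nuHat_cellSet {n : ℤ} {φ : Plane → Plane} (hφ : IsCell n φ) :
    nuHat (cellSet φ) = 3 ^ n := by
  rw [nuHat, (MeasurableEmbedding.subtype_coe isClosed_gasket.measurableSet).comap_apply,
    image_cellSet hφ, Measure.sum_apply _ (measurableSet_image hφ)]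
  have h : ∀ τ : unitMaps, (nu.map τ.1) (φ '' compactGasket) =
      nu (τ.1 ⁻¹' (φ '' compactGasket)) := fun τ =>
    Measure.map_apply (mem_unitMaps.1 τ.2).continuous.measurable (measurableSet_image hφ)
  simp_rw [h]
  obtain ⟨r, rfl | rfl⟩ := n.eq_nat_or_neg
  · rw [tsum_nu_of_nonneg hφ, zpow_natCast]
  · rw [tsum_nu_of_nonpos hφ, ENNReal.zpow_neg, zpow_natCast, ENNReal.inv_pow]

/-! ### Tent functions on triangles -/

lemma IsCell.invFun_apply {n : ℤ} {φ : Plane → Plane} (hφ : IsCell n φ) (x : Plane) :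
    Function.invFun φ (φ x) = x := Function.leftInverse_invFun hφ.injective x

lemma IsCell.apply_invFun {n : ℤ} {φ : Plane → Plane} (hφ : IsCell n φ) (y : Plane) :
    φ (Function.invFun φ y) = y := by
  obtain ⟨g, -, -, hg⟩ := hφ.exists_inverse
  exact Function.invFun_eq ⟨g y, hg y⟩

lemma IsCell.continuous_invFun {n : ℤ} {φ : Plane → Plane} (hφ : IsCell n φ) :
    Continuous (Function.invFun φ) := by
  obtain ⟨g, hg, -, hr⟩ := hφ.exists_inverse
  refine hg.congr fun y => hφ.injective ?_
  rw [hr, hφ.apply_invFun]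

/-- The tent function on the triangle `φ(compactGasket)`. -/
def bump (φ : Plane → Plane) (x : Plane) : ℝ := tent (Function.invFun φ x)

lemma bump_apply {n : ℤ} {φ : Plane → Plane} (hφ : IsCell n φ) (x : Plane) :
    bump φ (φ x) = tent x := by
  rw [bump, hφ.invFun_apply]

lemma exists_of_bump_ne_zero {n : ℤ} {φ : Plane → Plane} (hφ : IsCell n φ) {x : Plane}
    (h : bump φ x ≠ 0) : ∃ α, φ (coding α) = x ∧ ∀ j, α ≠ fun _ => j := by
  obtain ⟨α, hα, hc⟩ := exists_of_tent_ne_zero h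
  exact ⟨α, by rw [← hα, hφ.apply_invFun], hc⟩

/-- On a triangle of the same side other than the supporting one the function is `0`, since the two
meet only in corners. -/
lemma continuous_bump {n : ℤ} {φ : Plane → Plane} (hφ : IsCell n φ) :
    Continuous fun x : gasket => bump φ x := by
  refine continuous_of_continuousOn_cells n fun ψ hψ => ?_
  by_cases h : φ = ψ
  · subst h
    refine continuousOn_tent.comp hφ.continuous_invFun.continuousOn ?_
    rintro _ ⟨x, hx, rfl⟩
    rwa [hφ.invFun_apply]
  · refine (continuousOn_const (c := (0 : ℝ))).congr fun x hx => ?_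
    by_contra hne
    obtain ⟨α, rfl, hc⟩ := exists_of_bump_ne_zero hφ hne
    obtain ⟨β, hβ⟩ := mem_image_compactGasket.1 hx
    exact h (hφ.eq_of_level_eq hψ hβ.symm hc)

/-- The corners of a small triangle at which `bump φ` does not vanish belong to a proper
subtriangle. -/
lemma exists_subcell_of_bump_ne_zero {n n' : ℤ} {φ ψ : Plane → Plane} (hφ : IsCell n φ)
    (hψ : IsCell n' ψ) {j : Fin 3} (h : bump φ (ψ (corner j)) ≠ 0) :
    ∃ t : List (Fin 3), t ≠ [] ∧ n = n' + t.length ∧ ψ = φ ∘ Fword t := by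
  obtain ⟨α, hα, hc⟩ := exists_of_bump_ne_zero hφ h
  have hα' := hα
  rw [← coding_const] at hα'
  rcases hφ.nested hψ hα' hc with ⟨t, ht, hψ'⟩ | ⟨t, ht, hφ'⟩
  · refine ⟨t, ?_, ht, hψ'⟩
    rintro rfl
    rw [hψ'] at hα
    exact hc j (eq_const_of_coding_eq_corner (hφ.injective hα))
  · exfalso
    rw [hφ', Function.comp_apply, ← coding_cat] at hα
    exact hc j (cat_eq_const (eq_const_of_coding_eq_corner (hψ.injective hα)))

/-! ### Energy of tent functions -/

/-- Choosing a triangle and two of its corners for each edge is injective; overcounting is harmless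
for an upper bound. -/
lemma energyAt_le_tsum (m : ℕ) (U : Plane → ℝ) :
    energyAt m (fun x : gasket => U x) ≤ ∑' τ : unitMaps, ENNReal.ofReal
      (2⁻¹ * (5 / 3) ^ m * cornerEnergy fun j => U ((2 : ℝ) ^ (-m : ℤ) • τ.1 (corner j))) := by
  have h : ∀ e : {e : gasket × gasket // Neighbour m e.1 e.2},
      ∃ I : unitMaps × Fin 3 × Fin 3, (e.1.1 : Plane) = (2 : ℝ) ^ (-m : ℤ) • I.1.1 (corner I.2.1) ∧
        (e.1.2 : Plane) = (2 : ℝ) ^ (-m : ℤ) • I.1.1 (corner I.2.2) := by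
    rintro ⟨⟨x, y⟩, -, τ, hτ, ⟨_, ⟨_, ⟨i, rfl⟩, rfl⟩, hx⟩, ⟨_, ⟨_, ⟨j, rfl⟩, rfl⟩, hy⟩⟩
    refine ⟨⟨⟨τ, hτ⟩, i, j⟩, ?_, ?_⟩
    · rw [zpow_neg, zpow_natCast]; exact hx.symm
    · rw [zpow_neg, zpow_natCast]; exact hy.symm
  choose I h1 h2 using h
  have hI : Function.Injective I := fun e e' he => by
    refine Subtype.ext (Prod.ext (Subtype.ext ?_) (Subtype.ext ?_))
    · rw [h1, h1, he]
    · rw [h2, h2, he]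
  let f : unitMaps × Fin 3 × Fin 3 → ℝ≥0∞ := fun I => ENNReal.ofReal (2⁻¹ * (5 / 3) ^ m *
    (U ((2 : ℝ) ^ (-m : ℤ) • I.1.1 (corner I.2.1)) -
      U ((2 : ℝ) ^ (-m : ℤ) • I.1.1 (corner I.2.2))) ^ 2)
  calc energyAt m (fun x : gasket => U x) = ∑' e, f (I e) := by
        refine tsum_congr fun e => ?_
        simp only [f, h1, h2]
    _ ≤ ∑' I, f I := ENNReal.tsum_comp_le_tsum_of_injective hI f
    _ = _ := by
        rw [ENNReal.tsum_prod']
        refine tsum_congr fun τ => ?_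
        rw [tsum_fintype, ← ENNReal.ofReal_sum_of_nonneg fun _ _ => by positivity,
          cornerEnergy, ← Finset.mul_sum, Fintype.sum_prod_type]

/-- Only triangles properly inside the support contribute. If `n + m = r + 1` they are indexed by
words of length `r + 1`, and the sum is `2⁻¹ (5/3)ᵐ · 12 (3/5)ʳ = 10 (3/5)ⁿ`, whatever `m`. If `n +
m ≤ 0` the graph is too coarse to see the tent. -/
lemma energyAt_bump_le {n : ℤ} {φ : Plane → Plane} (hφ : IsCell n φ) (m : ℕ) :
    energyAt m (fun x : gasket => bump φ x) ≤ ENNReal.ofReal (10 * (3 / 5) ^ n) := by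
  classical
  refine (energyAt_le_tsum m (bump φ)).trans ?_
  set G : (Plane → Plane) → ℝ≥0∞ := fun τ => ENNReal.ofReal (2⁻¹ * (5 / 3) ^ m *
    cornerEnergy fun j => bump φ ((2 : ℝ) ^ (-m : ℤ) • τ (corner j))) with hG
  set φ' : Plane → Plane := fun x => (2 : ℝ) ^ (m : ℤ) • φ x with hφ'
  have hsub : ∀ τ ∈ unitMaps, G τ ≠ 0 →
      ∃ t : List (Fin 3), t ≠ [] ∧ n + m = t.length ∧ τ = φ' ∘ Fword t := by
    intro τ hτ hne
    have hψ := (mem_unitMaps.1 hτ).zpow_smul (-m)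
    obtain ⟨j, hj⟩ : ∃ j, bump φ ((2 : ℝ) ^ (-m : ℤ) • τ (corner j)) ≠ 0 := by
      by_contra! hall
      exact hne (by simp only [hG, hall, cornerEnergy]; simp)
    obtain ⟨t, ht, hn, he⟩ := exists_subcell_of_bump_ne_zero hφ hψ hj
    refine ⟨t, ht, by omega, ?_⟩
    funext x
    rw [hφ', Function.comp_apply, ← Function.comp_apply (f := φ), ← he, smul_smul,
      ← zpow_add₀ two_ne_zero, add_neg_cancel, zpow_zero, one_smul]
  by_cases hr : ∃ r : ℕ, n + m = r + 1
  · obtain ⟨r, hr⟩ := hr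
    rw [tsum_subtype unitMaps G, tsum_eq_sum (s := (words (r + 1)).image fun t => φ' ∘ Fword t),
      Finset.sum_image ((hφ.zpow_smul m).comp_Fword_injOn (r + 1))]
    · have hle : ∀ t ∈ words (r + 1), unitMaps.indicator G (φ' ∘ Fword t) ≤ ENNReal.ofReal
          (2⁻¹ * (5 / 3) ^ m * cornerEnergy fun j => tent (Fword t (corner j))) := fun t _ => by
        refine (Set.indicator_le_self _ _ _).trans_eq ?_
        simp only [hG, hφ', Function.comp_apply, smul_smul, ← zpow_add₀ (two_ne_zero (α := ℝ)),
          neg_add_cancel, zpow_zero, one_smul, bump_apply hφ]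
      refine (Finset.sum_le_sum hle).trans ?_
      rw [← ENNReal.ofReal_sum_of_nonneg fun _ _ => by unfold cornerEnergy; positivity,
        ← Finset.mul_sum, sum_cornerEnergy_tent]
      refine ENNReal.ofReal_le_ofReal (le_of_eq ?_)
      obtain rfl : n = (r + 1 : ℕ) - (m : ℤ) := by push_cast; omega
      rw [zpow_sub₀ (by norm_num), zpow_natCast, zpow_natCast, pow_succ, div_pow, div_pow, div_pow]
      field_simp
      norm_num
    · intro τ hnot
      by_contra hne
      have hmem : τ ∈ unitMaps := Set.mem_of_indicator_ne_zero hne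
      rw [Set.indicator_of_mem hmem] at hne
      obtain ⟨t, -, ht, rfl⟩ := hsub τ hmem hne
      exact hnot (Finset.mem_image.2 ⟨t, mem_words.2 (by omega), rfl⟩)
  · have hz : ∀ τ : unitMaps, G τ.1 = 0 := fun τ => by
      by_contra hne
      obtain ⟨t, ht, hn, -⟩ := hsub τ.1 τ.2 hne
      have := List.length_pos_iff.2 ht
      exact hr ⟨t.length - 1, by omega⟩
    rw [ENNReal.tsum_eq_zero.2 hz]
    exact zero_le

lemma energy_bump_le {n : ℤ} {φ : Plane → Plane} (hφ : IsCell n φ) :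
    energy (fun x : gasket => bump φ x) ≤ ENNReal.ofReal (10 * (3 / 5) ^ n) :=
  iSup_le (energyAt_bump_le hφ)

/-! ### Norms of tent functions -/

lemma eLpNorm_bump_le {n : ℤ} {φ : Plane → Plane} (hφ : IsCell n φ) (σ : Measure gasket) {p : ℝ}
    (hp : 0 < p) :
    eLpNorm (fun x : gasket => bump φ x) (ENNReal.ofReal p) σ ≤ σ (cellSet φ) ^ (1 / p) := by
  have h := eLpNorm_indicator_const (μ := σ) (c := (1 : ℝ)) (p := ENNReal.ofReal p)
    (measurableSet_cellSet hφ) (by simpa using hp) ENNReal.ofReal_ne_top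
  rw [ENNReal.toReal_ofReal hp.le, enorm_one, one_mul] at h
  rw [← h]
  refine eLpNorm_mono_real fun x => ?_
  have hx := tent_mem_Icc (Function.invFun φ x)
  rw [Real.norm_of_nonneg (show 0 ≤ bump φ x from hx.1)]
  by_cases hmem : x ∈ cellSet φ
  · rw [Set.indicator_of_mem hmem]; exact hx.2
  · rw [Set.indicator_of_notMem hmem]
    by_contra! hne
    obtain ⟨α, hα, -⟩ := exists_of_bump_ne_zero hφ hne.ne'
    exact hmem (mem_image_compactGasket.2 ⟨α, hα⟩)

lemma le_eLpNorm_bump {n : ℤ} {φ : Plane → Plane} (hφ : IsCell n φ) {q : ℝ} (hq : 0 < q) :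
    ENNReal.ofReal (3 / 5) * (3 ^ (n - 2)) ^ (1 / q) ≤
      eLpNorm (fun x : gasket => bump φ x) (ENNReal.ofReal q) nuHat := by
  have hψ : IsCell (n - 2) (φ ∘ Fword [0, 1]) := hφ.comp_Fword [0, 1]
  have h := eLpNorm_indicator_const (μ := nuHat) (c := (3 / 5 : ℝ)) (p := ENNReal.ofReal q)
    (measurableSet_cellSet hψ) (by simpa using hq) ENNReal.ofReal_ne_top
  rw [ENNReal.toReal_ofReal hq.le, nuHat_cellSet hψ, Real.enorm_of_nonneg (by norm_num)] at h
  rw [← h]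
  refine eLpNorm_mono fun x => ?_
  have hx := tent_mem_Icc (Function.invFun φ x)
  rw [Real.norm_of_nonneg (show 0 ≤ bump φ x from hx.1)]
  by_cases hmem : x ∈ cellSet (φ ∘ Fword [0, 1])
  · rw [Set.indicator_of_mem hmem, Real.norm_of_nonneg (by norm_num)]
    obtain ⟨α, hα⟩ := mem_image_compactGasket.1 hmem
    rw [← hα, Function.comp_apply, bump_apply hφ]
    exact tent_ge α
  · rw [Set.indicator_of_notMem hmem, norm_zero]
    exact hx.1

lemma bump_mem_domain {n : ℤ} {φ : Plane → Plane} (hφ : IsCell n φ) :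
    (⟨fun x : gasket => bump φ x, continuous_bump hφ⟩ : C(gasket, ℝ)) ∈ domain := by
  refine ⟨(energy_bump_le hφ).trans_lt ENNReal.ofReal_lt_top,
    (continuous_bump hφ).aestronglyMeasurable, ?_⟩
  have h := eLpNorm_bump_le hφ nuHat (p := 2) (by norm_num)
  rw [nuHat_cellSet hφ, ENNReal.ofReal_ofNat] at h
  refine h.trans_lt (ENNReal.rpow_lt_top_of_nonneg (by norm_num) ?_)
  exact (ENNReal.zpow_lt_top (by norm_num) (by norm_num) n).ne

lemma diam_cellSet {n : ℤ} {φ : Plane → Plane} (hφ : IsCell n φ) :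
    Metric.diam (cellSet φ) = 2 ^ n := by
  rw [← isometry_subtype_coe.diam_image (s := cellSet φ), image_cellSet hφ]
  apply le_antisymm
  · refine Metric.diam_le_of_forall_dist_le (by positivity) ?_
    rintro x hx y hy
    obtain ⟨α, rfl⟩ := mem_image_compactGasket.1 hx
    obtain ⟨β, rfl⟩ := mem_image_compactGasket.1 hy
    rw [hφ.dist_eq]
    exact mul_le_of_le_one_right (by positivity) (dist_coding_le α β)
  · have h := Metric.dist_le_diam_of_mem hφ.isCompact_image.isBounded
      (mem_image_compactGasket.2 ⟨fun _ => 0, rfl⟩) (mem_image_compactGasket.2 ⟨fun _ => 1, rfl⟩)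
    rwa [hφ.dist_eq, coding_const, coding_const, dist_corner_zero_one, mul_one] at h

lemma IsDyadicTriangle.exists_cell {S : Set gasket} (hS : IsDyadicTriangle S) :
    ∃ n φ, IsCell n φ ∧ S = cellSet φ := by
  obtain ⟨m, τ, hτ, rfl⟩ := hS
  refine ⟨0 + m, _, (mem_unitMaps.1 hτ).zpow_smul m, ?_⟩
  rw [cellSet, ← Set.image_smul, Set.image_image]

/-! ### The lower bound -/

/-- The exponent `θ` with `(3/5)ⁿ = (3ⁿ)^(-θ)`. -/
def energyExponent : ℝ := Real.log (5 / 3) / Real.log 3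

lemma energyExponent_nonneg : 0 ≤ energyExponent :=
  div_nonneg (Real.log_nonneg (by norm_num)) (Real.log_nonneg (by norm_num))

lemma three_fifths_zpow (n : ℤ) : (3 / 5 : ℝ) ^ n = ((3 : ℝ) ^ n) ^ (-energyExponent) := by
  rw [← Real.rpow_intCast, ← Real.rpow_intCast, ← Real.rpow_mul (by norm_num),
    Real.rpow_def_of_pos (by norm_num), Real.rpow_def_of_pos (by norm_num)]
  congr 1
  have h3 : Real.log 3 ≠ 0 := (Real.log_pos (by norm_num)).ne'
  have h : Real.log (3 / 5) = -Real.log (5 / 3) := by rw [← Real.log_inv]; norm_num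
  rw [energyExponent, h]
  field_simp

/-- The Sobolev inequality for the tent function, solved for the measure `y` of the triangle. -/
lemma exists_rpow_le_of_sobolev {p q C : ℝ} (hp : 0 < p) (hC : 0 < C) {N : ℕ} (hN : 1 ≤ N)
    {b : Fin N → ℝ} (hb : ∀ i, 0 ≤ b i ∧ b i < 1) {n : ℤ} {y : ℝ} (hy : 0 ≤ y)
    (h : 3 / 5 * ((3 : ℝ) ^ (n - 2)) ^ (1 / q) ≤
      C * ∑ i, (10 * (3 / 5 : ℝ) ^ n) ^ (b i / 2) * (y ^ (1 / p)) ^ (1 - b i)) :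
    ∃ i, (3 / 5 * 9 ^ (-(1 / q)) / (C * N * 10 ^ (b i / 2)) : ℝ) ^ (p / (1 - b i)) *
      ((3 : ℝ) ^ n) ^ ((1 / q + energyExponent * (b i / 2)) * (p / (1 - b i))) ≤ y := by
  have : Nonempty (Fin N) := ⟨⟨0, hN⟩⟩
  have hN0 : (0 : ℝ) < N := by exact_mod_cast hN
  set x : ℝ := 3 ^ n with hx
  have hx0 : 0 < x := by positivity
  obtain ⟨i, -, hi⟩ := Finset.exists_le_of_sum_le (s := Finset.univ)
    (f := fun _ : Fin N => 3 / 5 * ((3 : ℝ) ^ (n - 2)) ^ (1 / q) / (C * N))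
    (g := fun i => (10 * (3 / 5 : ℝ) ^ n) ^ (b i / 2) * (y ^ (1 / p)) ^ (1 - b i))
    Finset.univ_nonempty (by
      rw [Finset.sum_const, Finset.card_univ, Fintype.card_fin, nsmul_eq_mul]
      calc (N : ℝ) * (3 / 5 * ((3 : ℝ) ^ (n - 2)) ^ (1 / q) / (C * N))
          = 3 / 5 * ((3 : ℝ) ^ (n - 2)) ^ (1 / q) / C := by field_simp
        _ ≤ _ := by rw [div_le_iff₀' hC]; exact h)
  refine ⟨i, ?_⟩
  have hbi : 0 < 1 - b i := by linarith [(hb i).2]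
  have hκ : 0 < p / (1 - b i) := by positivity
  set e : ℝ := 1 / q + energyExponent * (b i / 2)
  have h9 : ((3 : ℝ) ^ (n - 2)) ^ (1 / q) = x ^ (1 / q) * 9 ^ (-(1 / q)) := by
    rw [zpow_sub₀ (by norm_num), Real.div_rpow (by positivity) (by positivity),
      Real.rpow_neg (by norm_num), div_eq_mul_inv, hx]
    norm_num
  have h10 : (10 * (3 / 5 : ℝ) ^ n) ^ (b i / 2) =
      10 ^ (b i / 2) * x ^ (-(energyExponent * (b i / 2))) := by
    rw [Real.mul_rpow (by norm_num) (by positivity), three_fifths_zpow, ← Real.rpow_mul hx0.le,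
      neg_mul]
  have hxe : x ^ (1 / q) = x ^ e * x ^ (-(energyExponent * (b i / 2))) := by
    rw [← Real.rpow_add hx0]; congr 1; ring
  -- The energy factor `x^(-θ bᵢ/2)` is cancelled, which raises the exponent from `1/q` to `e`.
  have hA : 3 / 5 * 9 ^ (-(1 / q)) / (C * N * 10 ^ (b i / 2)) * x ^ e ≤
      y ^ ((1 - b i) / p) := by
    have hyp : (y ^ (1 / p)) ^ (1 - b i) = y ^ ((1 - b i) / p) := by
      rw [← Real.rpow_mul hy]; congr 1; ring
    simp only [h9, h10, hxe, hyp] at hi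
    have hz : 0 < x ^ (-(energyExponent * (b i / 2))) := by positivity
    have ht : (0 : ℝ) < 10 ^ (b i / 2) := by positivity
    refine le_of_mul_le_mul_left (le_of_eq_of_le ?_ hi) (mul_pos ht hz)
    field_simp
  calc _ = (3 / 5 * 9 ^ (-(1 / q)) / (C * N * 10 ^ (b i / 2)) * x ^ e) ^ (p / (1 - b i)) := by
        rw [Real.mul_rpow (by positivity) (by positivity), ← Real.rpow_mul hx0.le]
    _ ≤ (y ^ ((1 - b i) / p)) ^ (p / (1 - b i)) := by gcongr
    _ = y := by
        rw [← Real.rpow_mul hy, div_mul_div_cancel₀ hp.ne', div_self hbi.ne', Real.rpow_one]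

lemma ofReal_three_zpow (n : ℤ) : (3 : ℝ≥0∞) ^ n = ENNReal.ofReal ((3 : ℝ) ^ n) := by
  obtain ⟨r, rfl | rfl⟩ := n.eq_nat_or_neg
  · rw [zpow_natCast, zpow_natCast, ENNReal.ofReal_pow (by norm_num), ENNReal.ofReal_ofNat]
  · rw [ENNReal.zpow_neg, zpow_neg, zpow_natCast, zpow_natCast,
      ENNReal.ofReal_inv_of_pos (by positivity), ENNReal.ofReal_pow (by norm_num),
      ENNReal.ofReal_ofNat]

/-- The Sobolev inequality for the tent function on a triangle of finite measure. -/
lemma sobolev_tent {σ : Measure gasket} {p q C : ℝ} (hp : 0 < p) (hq : 0 < q) {N : ℕ}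
    {b : Fin N → ℝ} (hb : ∀ i, 0 ≤ b i ∧ b i < 1) (hC : 0 < C)
    (hsob : ∀ u ∈ domain, eLpNorm u (ENNReal.ofReal q) nuHat ≤
      ENNReal.ofReal C * ∑ i, energy u ^ (b i / 2) *
        eLpNorm u (ENNReal.ofReal p) σ ^ (1 - b i))
    {n : ℤ} {φ : Plane → Plane} (hφ : IsCell n φ) (hσ : σ (cellSet φ) ≠ ∞) :
    3 / 5 * ((3 : ℝ) ^ (n - 2)) ^ (1 / q) ≤ C * ∑ i, (10 * (3 / 5 : ℝ) ^ n) ^ (b i / 2) *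
      ((σ (cellSet φ)).toReal ^ (1 / p)) ^ (1 - b i) := by
  have h1 := hsob _ (bump_mem_domain hφ)
  have h2 : ENNReal.ofReal (3 / 5) * (3 ^ (n - 2)) ^ (1 / q) ≤ ENNReal.ofReal C *
      ∑ i, ENNReal.ofReal (10 * (3 / 5 : ℝ) ^ n) ^ (b i / 2) *
        (σ (cellSet φ) ^ (1 / p)) ^ (1 - b i) := by
    refine (le_eLpNorm_bump hφ hq).trans (h1.trans ?_)
    gcongr with i
    · exact div_nonneg (hb i).1 (by norm_num)
    · exact energy_bump_le hφ
    · exact sub_nonneg.2 (hb i).2.le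
    · exact eLpNorm_bump_le hφ σ hp
  have hnn : ∀ i, 0 ≤ (10 * (3 / 5 : ℝ) ^ n) ^ (b i / 2) *
      ((σ (cellSet φ)).toReal ^ (1 / p)) ^ (1 - b i) := fun i => by positivity
  rw [← ENNReal.ofReal_le_ofReal_iff (mul_nonneg hC.le (Finset.sum_nonneg fun i _ => hnn i)),
    ENNReal.ofReal_mul (by norm_num), ENNReal.ofReal_mul hC.le,
    ENNReal.ofReal_sum_of_nonneg fun i _ => hnn i,
    ← ENNReal.ofReal_rpow_of_nonneg (by positivity) (by positivity), ← ofReal_three_zpow]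
  refine h2.trans_eq ?_
  congr 1
  refine Finset.sum_congr rfl fun i _ => ?_
  rw [ENNReal.ofReal_mul (p := (10 * (3 / 5 : ℝ) ^ n) ^ (b i / 2)) (by positivity),
    ← ENNReal.ofReal_rpow_of_nonneg (by positivity) (div_nonneg (hb i).1 (by norm_num)),
    ← ENNReal.ofReal_rpow_of_nonneg (by positivity) (sub_nonneg.2 (hb i).2.le),
    ← ENNReal.ofReal_rpow_of_nonneg (by positivity) (by positivity), ENNReal.ofReal_toReal hσ]

lemma ofReal_mul_nuHat_le {σ : Measure gasket} {n : ℤ} {φ : Plane → Plane} (hφ : IsCell n φ)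
    {c e : ℝ} (hc : 0 ≤ c) (he : 0 ≤ e) (hσ : σ (cellSet φ) ≠ ∞)
    (h : c * ((3 : ℝ) ^ n) ^ e ≤ (σ (cellSet φ)).toReal) :
    ENNReal.ofReal c * nuHat (cellSet φ) ^ e ≤ σ (cellSet φ) := by
  rw [nuHat_cellSet hφ, ofReal_three_zpow, ENNReal.ofReal_rpow_of_nonneg (by positivity) he,
    ← ENNReal.ofReal_mul hc, ← ENNReal.ofReal_toReal hσ]
  exact ENNReal.ofReal_le_ofReal h

end Gasket

end

theorem mainTheorem9 (σ : Measure Gasket.gasket) (p q : ℝ) (hp : 0 < p) (hq : 0 < q)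
    (N : ℕ) (hN : 1 ≤ N) (b : Fin N → ℝ) (hb : ∀ i, 0 ≤ b i ∧ b i < 1) (C : ℝ) (hC : 0 < C)
    (hsob : ∀ u ∈ Gasket.domain,
      eLpNorm u (ENNReal.ofReal q) Gasket.nuHat ≤
        ENNReal.ofReal C * ∑ i, Gasket.energy u ^ (b i / 2) *
          eLpNorm u (ENNReal.ofReal p) σ ^ (1 - b i)) :
    ∃ Cσ δ₁ δ₂ : ℝ, 1 ≤ Cσ ∧ 0 < δ₁ ∧ δ₁ ≤ δ₂ ∧ Gasket.LowerDyadic σ Cσ δ₁ δ₂ := by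
  have : Nonempty (Fin N) := ⟨⟨0, hN⟩⟩
  have hN0 : (0 : ℝ) < N := by exact_mod_cast hN
  have hbi : ∀ i, 0 < 1 - b i := fun i => by linarith [(hb i).2]
  set K : Fin N → ℝ := fun i =>
    (3 / 5 * 9 ^ (-(1 / q)) / (C * N * 10 ^ (b i / 2)) : ℝ) ^ (p / (1 - b i)) with hK
  set e : Fin N → ℝ := fun i =>
    (1 / q + Gasket.energyExponent * (b i / 2)) * (p / (1 - b i)) with he
  have hK0 : ∀ i, 0 < K i := fun i => by positivity
  have he0 : ∀ i, 0 < e i := fun i => by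
    have := mul_nonneg Gasket.energyExponent_nonneg (div_nonneg (hb i).1 zero_le_two)
    have := hbi i
    positivity
  -- The index supplied by the pigeonhole varies with the triangle, so the exponents are replaced by
  -- their extremes and the constants `K i` by a common lower bound `Cσ⁻¹`.
  obtain ⟨i₁, hi₁⟩ := Finite.exists_max e
  obtain ⟨i₂, hi₂⟩ := Finite.exists_min e
  set Cσ : ℝ := max 1 (∑ i, (K i)⁻¹) with hCσ
  have hCK : ∀ i, Cσ⁻¹ ≤ K i := fun i => by
    refine inv_le_of_inv_le₀ (hK0 i) (le_max_of_le_right ?_)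
    exact Finset.single_le_sum (f := fun i => (K i)⁻¹) (fun i _ => (inv_pos.2 (hK0 i)).le)
      (Finset.mem_univ i)
  have hC0 : 0 ≤ Cσ⁻¹ := inv_nonneg.2 (zero_le_one.trans (le_max_left _ _))
  refine ⟨Cσ, 1 / e i₁, 1 / e i₂, le_max_left _ _, one_div_pos.2 (he0 i₁),
    one_div_le_one_div_of_le (he0 i₂) (hi₁ i₂), fun S hS => ?_⟩
  obtain ⟨n, φ, hφ, rfl⟩ := hS.exists_cell
  rw [Gasket.diam_cellSet hφ, one_div_one_div, one_div_one_div]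
  by_cases hσ : σ (Gasket.cellSet φ) = ∞
  · rw [hσ]; exact ⟨fun _ => le_top, fun _ => le_top⟩
  obtain ⟨i, hi⟩ := Gasket.exists_rpow_le_of_sobolev hp hC hN hb ENNReal.toReal_nonneg
    (Gasket.sobolev_tent hp hq hb hC hsob hφ hσ)
  refine ⟨fun h => ?_, fun h => ?_⟩
  · have hn : n < 0 := by
      by_contra! hn
      exact h.2.not_ge (one_le_zpow₀ one_le_two hn)
    refine Gasket.ofReal_mul_nuHat_le hφ hC0 (he0 i₁).le hσ (le_trans ?_ hi)
    have := hK0 i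
    refine mul_le_mul (hCK i) ?_ (by positivity) (hK0 i).le
    -- Here `3ⁿ ≤ 1`, so the largest exponent gives the smallest power; for `n ≥ 0` the order is
    -- reversed.
    exact Real.rpow_le_rpow_of_exponent_ge (by positivity)
      (zpow_le_one_of_nonpos₀ (by norm_num) hn.le) (hi₁ i)
  · have hn : 0 ≤ n := by
      by_contra! hn
      exact h.not_gt (zpow_lt_one_of_neg₀ one_lt_two hn)
    refine Gasket.ofReal_mul_nuHat_le hφ hC0 (he0 i₂).le hσ (le_trans ?_ hi)
    refine mul_le_mul (hCK i) ?_ (by positivity) (hK0 i).le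
    exact Real.rpow_le_rpow_of_exponent_le (one_le_zpow₀ (by norm_num) hn) (hi₂ i)
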